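/- Consider the Rayleigh--B\'enard system at infinite Prandtl number in the layer $\{(x,y,z): (x,y)\in\mathbb{R}^2,\ 0\le z\le 1\}$, $$\partial_t T+\mathbf{u}\cdot\nabla T-\Delta T=0,\qquad \nabla\cdot\mathbf{u}=0,\qquad \nabla p-\Delta\mathbf{u}=\mathrm{Ra}\,T\,\mathbf{e}_z ,$$ where $\mathbf{u}=(u^x,u^y,u^z)$, $\mathbf{e}_z=(0,0,1)$ and $t>0$, with all functions periodic in $x$ and $y$ with periods $L_x>0$ and $L_y>0$, with $T=1$ at $z=0$ and $T=0$ at $z=1$, and with the no-slip boundary conditions $\mathbf{u}=0$ at $z\in\{0,1\}$. A solution is understood to be classical for $t>0$, up to the plates ($T$ of class $C^1$ in $(t,x,y,z)$ and, at each time, $C^2$ in space; $\mathbf{u}$ continuous in $(t,x,y,z)$ and, at each time, $C^2$ in space; $p$, at each time, $C^1$ in space), with $T(t)\to T(0)$ in $L^2([0,L_x]\times[0,L_y]\times[0,1])$ as $t\downarrow 0$, where $T(0)$ is an arbitrary function in that space. Its Nusselt number is $$\mathrm{Nu}=\limsup_{t\to\infty}\frac1t\int_0^t\frac{1}{L_xL_y}\int_0^{L_x}\!\int_0^{L_y}\!\int_0^1(\mathbf{u}T-\nabla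 T)\cdot\mathbf{e}_z\,dz\,dy\,dx\,ds .$$ There is a universal constant $C>0$, independent of $L_x$, $L_y$, $\mathrm{Ra}$ and the solution, such that for every $\mathrm{Ra}\ge 1$ and every solution the integrals (first in space, then in time) that define $\mathrm{Nu}$ converge and $$\mathrm{Nu}\le C\,\mathrm{Ra}^{2/5}.$$ -/

import Mathlib

open MeasureTheory Filter Topology Set
open scoped ENNReal

noncomputable section

namespace RayleighBenard

/-- Points `(x, y, z)` of three-dimensional space; `z` is the vertical coordinate. -/
abbrev Pt : Type := ℝ × ℝ × ℝ

/-- The closed layer `ℝ² × [0,1]`. -/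
def slab : Set Pt := {q | 0 ≤ q.2.2 ∧ q.2.2 ≤ 1}

/-- The open layer `ℝ² × (0,1)`. -/
def openSlab : Set Pt := {q | 0 < q.2.2 ∧ q.2.2 < 1}

/-- The periodicity cell `[0,Lx] × [0,Ly] × [0,1]`. -/
def cell (Lx Ly : ℝ) : Set Pt := Icc 0 Lx ×ˢ Icc 0 Ly ×ˢ Icc 0 1

/-- The partial derivative `∂ₓ f`. -/
def dx (f : Pt → ℝ) (q : Pt) : ℝ := deriv (fun s => f (s, q.2.1, q.2.2)) q.1

/-- The partial derivative `∂_y f`. -/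
def dy (f : Pt → ℝ) (q : Pt) : ℝ := deriv (fun s => f (q.1, s, q.2.2)) q.2.1

/-- The partial derivative `∂_z f`. -/
def dz (f : Pt → ℝ) (q : Pt) : ℝ := deriv (fun s => f (q.1, q.2.1, s)) q.2.2

/-- The Laplacian `∂ₓ² f + ∂_y² f + ∂_z² f`. -/
def lap (f : Pt → ℝ) (q : Pt) : ℝ := dx (dx f) q + dy (dy f) q + dz (dz f) q

/-- Periodicity in the horizontal variables, with periods `Lx` and `Ly`. -/
def HorizontallyPeriodic (Lx Ly : ℝ) (f : Pt → ℝ) : Prop :=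
  ∀ x y z : ℝ, 0 ≤ z → z ≤ 1 →
    f (x + Lx, y, z) = f (x, y, z) ∧ f (x, y + Ly, z) = f (x, y, z)

/-- Solutions `(T, (ux, uy, uz), p)` of the Rayleigh–Bénard system at infinite Prandtl number in
the layer `ℝ² × [0,1]`, horizontally periodic, with no-slip conditions at both plates. They are
classical for positive times, up to the plates, and take their initial temperature `T 0`, an
arbitrary square-integrable function, in the `L²` sense. The first argument of every field
is the time. -/
structure IsSolution (Ra Lx Ly : ℝ) (T ux uy uz p : ℝ → Pt → ℝ) : Prop where
  T_periodic : ∀ t, 0 < t → HorizontallyPeriodic Lx Ly (T t)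
  ux_periodic : ∀ t, 0 < t → HorizontallyPeriodic Lx Ly (ux t)
  uy_periodic : ∀ t, 0 < t → HorizontallyPeriodic Lx Ly (uy t)
  uz_periodic : ∀ t, 0 < t → HorizontallyPeriodic Lx Ly (uz t)
  p_periodic : ∀ t, 0 < t → HorizontallyPeriodic Lx Ly (p t)
  T_contDiffOn : ContDiffOn ℝ 1 (fun r : ℝ × Pt => T r.1 r.2) (Ioi 0 ×ˢ slab)
  T_contDiffOn_space : ∀ t, 0 < t → ContDiffOn ℝ 2 (T t) slab
  ux_continuousOn : ContinuousOn (fun r : ℝ × Pt => ux r.1 r.2) (Ioi 0 ×ˢ slab)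
  uy_continuousOn : ContinuousOn (fun r : ℝ × Pt => uy r.1 r.2) (Ioi 0 ×ˢ slab)
  uz_continuousOn : ContinuousOn (fun r : ℝ × Pt => uz r.1 r.2) (Ioi 0 ×ˢ slab)
  ux_contDiffOn_space : ∀ t, 0 < t → ContDiffOn ℝ 2 (ux t) slab
  uy_contDiffOn_space : ∀ t, 0 < t → ContDiffOn ℝ 2 (uy t) slab
  uz_contDiffOn_space : ∀ t, 0 < t → ContDiffOn ℝ 2 (uz t) slab
  p_contDiffOn_space : ∀ t, 0 < t → ContDiffOn ℝ 1 (p t) slab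
  /-- `∂ₜ T + u · ∇T - ΔT = 0` -/
  temperature : ∀ t, 0 < t → ∀ q ∈ openSlab,
    deriv (fun s => T s q) t
      + (ux t q * dx (T t) q + uy t q * dy (T t) q + uz t q * dz (T t) q)
      - lap (T t) q = 0
  /-- `∇ · u = 0` -/
  incompressible : ∀ t, 0 < t → ∀ q ∈ openSlab,
    dx (ux t) q + dy (uy t) q + dz (uz t) q = 0
  /-- The three components of `∇p - Δu = Ra T e_z`. -/
  momentum_x : ∀ t, 0 < t → ∀ q ∈ openSlab, dx (p t) q - lap (ux t) q = 0
  momentum_y : ∀ t, 0 < t → ∀ q ∈ openSlab, dy (p t) q - lap (uy t) q = 0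
  momentum_z : ∀ t, 0 < t → ∀ q ∈ openSlab, dz (p t) q - lap (uz t) q = Ra * T t q
  T_bottom : ∀ t, 0 < t → ∀ x y : ℝ, T t (x, y, 0) = 1
  T_top : ∀ t, 0 < t → ∀ x y : ℝ, T t (x, y, 1) = 0
  no_slip_bottom : ∀ t, 0 < t → ∀ x y : ℝ,
    ux t (x, y, 0) = 0 ∧ uy t (x, y, 0) = 0 ∧ uz t (x, y, 0) = 0
  no_slip_top : ∀ t, 0 < t → ∀ x y : ℝ,
    ux t (x, y, 1) = 0 ∧ uy t (x, y, 1) = 0 ∧ uz t (x, y, 1) = 0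
  initial_memLp : MemLp (T 0) 2 (volume.restrict (cell Lx Ly))
  initial_tendsto :
    Tendsto (fun t => eLpNorm (fun q => T t q - T 0 q) 2 (volume.restrict (cell Lx Ly)))
      (𝓝[>] 0) (𝓝 0)

/-- The density `(u T - ∇T) · e_z` of the vertical heat flux at time `s`. -/
def fluxDensity (T uz : ℝ → Pt → ℝ) (s : ℝ) (q : Pt) : ℝ :=
  uz s q * T s q - dz (T s) q

/-- The horizontal average of `∫₀¹ (u T - ∇T) · e_z dz` at time `s`. -/
def heatFlux (Lx Ly : ℝ) (T uz : ℝ → Pt → ℝ) (s : ℝ) : ℝ :=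
  (Lx * Ly)⁻¹ * ∫ q in cell Lx Ly, fluxDensity T uz s q

/-- The Nusselt number `limsup_{t → ∞} (1/t) ∫₀ᵗ heatFlux ds`, as an extended real number (so that
an unbounded average counts as `+∞`). -/
def nusselt (Lx Ly : ℝ) (T uz : ℝ → Pt → ℝ) : EReal :=
  limsup (fun t : ℝ => ((t⁻¹ * ∫ s in (0 : ℝ)..t, heatFlux Lx Ly T uz s : ℝ) : EReal)) atTop

end RayleighBenard

end

noncomputable section

namespace RayleighBenard

/-! The proof is the background method. The profile τ = (1 - z)^(m+1) falls from 1 to 0 in a layer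
of width about 1/(m+1) at the lower plate alone. Put θ = T - τ and φ = 2τ - (1 - z). Then φ - T
vanishes at both plates, and testing the heat equation with it gives, over the cell
(`Snapshot.energy_identity`), total flux = ∫(φ - T) ∂ₜT + ∫τ'² - ∫|∇θ|² - 2∫τ' w θ. The first term
is the time derivative of a functional that is bounded above by completing a square (`lyapunov_le`),
so it contributes nothing positive to long-time averages; no maximum principle is needed. The second
is at most (m+1) times the area of the plate. Hence Nu ≤ m + 1 as soon as -2∫τ' w θ ≤ ∫|∇θ|²
(`Snapshot.spectral_constraint`).

This last inequality lives near the lower plate, where the vertical velocity w vanishes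
quadratically by no-slip and incompressibility. Each horizontal Fourier mode of w, with squared wave
number κ, solves (∂² - κ)² w = Ra κ f with clamped ends. Testing with w bounds w'' in L² uniformly
in κ, and a localised test function turns this into a pointwise bound on w'' in the lower half of
the layer that costs at most a factor 1 + κ in the square (`ClampedMode.sq_second_pointwise`). That
factor is the weight of one horizontal derivative of the forcing, and the forcing may be taken to be
θ because the pressure absorbs a function of z. So, by Parseval, the integral of w² over a slice is
at most 66 Ra² z⁴ ∫|∇θ|², while that of θ² is at most z ∫|∇θ|².

Against -τ', the weights z⁴ and z integrate to at most 24/(m+1)⁴ and 1/(m+1). Balancing them by a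
weighted arithmetic-geometric inequality leaves a constant times Ra (m+1)^(-5/2) ∫|∇θ|², which is
admissible once m + 1 is a large multiple of Ra^(2/5). -/

/-! ### One-variable inequalities -/

/-- Cauchy–Schwarz against the constant `1`: `(∫ f)² ≤ (b - a) ∫ f²`. -/
theorem sq_intervalIntegral_le {a b : ℝ} (hab : a ≤ b) {f : ℝ → ℝ}
    (hf : ContinuousOn f (Icc a b)) :
    (∫ x in a..b, f x) ^ 2 ≤ (b - a) * ∫ x in a..b, f x ^ 2 := by
  rcases hab.eq_or_lt with rfl | hlt
  · simp
  have h1 : IntervalIntegrable f volume a b := hf.intervalIntegrable_of_Icc hab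
  have h2 : IntervalIntegrable (fun x => f x ^ 2) volume a b :=
    (hf.pow 2).intervalIntegrable_of_Icc hab
  -- With `m` the mean of `f`, the inequality is the nonnegativity of the variance.
  set m := (∫ x in a..b, f x) / (b - a) with hm
  have hpos : 0 < b - a := by linarith
  have key : 0 ≤ ∫ x in a..b, (f x - m) ^ 2 :=
    intervalIntegral.integral_nonneg hab fun x _ => sq_nonneg _
  have expand : ∫ x in a..b, (f x - m) ^ 2
      = (∫ x in a..b, f x ^ 2) - 2 * m * (∫ x in a..b, f x) + (b - a) * m ^ 2 := by
    have : (fun x => (f x - m) ^ 2) = fun x => (f x ^ 2 - 2 * m * f x) + m ^ 2 := by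
      funext x; ring
    rw [this, intervalIntegral.integral_add (h2.sub (h1.const_mul _)) (by simp),
      intervalIntegral.integral_sub h2 (h1.const_mul _), intervalIntegral.integral_const_mul]
    simp
  have hI : (∫ x in a..b, f x) = m * (b - a) := by rw [hm]; field_simp
  rw [expand, hI] at key
  rw [hI]
  nlinarith

/-- Integrals of nonnegative functions increase with the interval. -/
theorem intervalIntegral_mono_of_nonneg {a b c d : ℝ} (hac : a ≤ c) (hcd : c ≤ d) (hdb : d ≤ b)
    {f : ℝ → ℝ} (hf : ContinuousOn f (Icc a b)) (h0 : ∀ x, 0 ≤ f x) :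
    ∫ x in c..d, f x ≤ ∫ x in a..b, f x :=
  intervalIntegral.integral_mono_interval hac hcd hdb (.of_forall h0)
    (hf.intervalIntegrable_of_Icc (hac.trans (hcd.trans hdb)))

/-- A function vanishing at `0` is controlled by the square integral of its derivative. -/
theorem sq_le_of_hasDerivAt {f g : ℝ → ℝ} (hf : ContinuousOn f (Icc 0 1))
    (hg : ContinuousOn g (Icc 0 1)) (h : ∀ z ∈ Ioo (0 : ℝ) 1, HasDerivAt f (g z) z) (h0 : f 0 = 0)
    {z : ℝ} (hz : z ∈ Icc (0 : ℝ) 1) : f z ^ 2 ≤ z * ∫ s in (0 : ℝ)..1, g s ^ 2 := by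
  have hsub : Icc 0 z ⊆ Icc (0 : ℝ) 1 := Icc_subset_Icc_right hz.2
  have e : ∫ s in (0 : ℝ)..z, g s = f z := by
    rw [intervalIntegral.integral_eq_sub_of_hasDerivAt_of_le hz.1 (hf.mono hsub)
      (fun x hx => h x ⟨hx.1, hx.2.trans_le hz.2⟩)
      ((hg.mono hsub).intervalIntegrable_of_Icc hz.1), h0, sub_zero]
  rw [← e]
  refine (sq_intervalIntegral_le hz.1 (hg.mono hsub)).trans ?_
  rw [sub_zero]
  exact mul_le_mul_of_nonneg_left
    (intervalIntegral_mono_of_nonneg le_rfl hz.1 hz.2 (hg.pow 2) fun _ => sq_nonneg _) hz.1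

/-! ### The clamped fourth-order equation of a single mode -/

/-- The vertical profile `w₀` of a horizontal Fourier mode of the vertical velocity, with its
derivatives `w₁, w₂, w₃`: the fourth-order equation `(∂² - κ)² w₀ = R κ f` with clamped ends. -/
structure ClampedMode (κ R : ℝ) (w₀ w₁ w₂ w₃ f : ℝ → ℝ) : Prop where
  c₀ : ContinuousOn w₀ (Icc 0 1)
  c₁ : ContinuousOn w₁ (Icc 0 1)
  c₂ : ContinuousOn w₂ (Icc 0 1)
  c₃ : ContinuousOn w₃ (Icc 0 1)
  cf : ContinuousOn f (Icc 0 1)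
  d₀ : ∀ z ∈ Ioo (0 : ℝ) 1, HasDerivAt w₀ (w₁ z) z
  d₁ : ∀ z ∈ Ioo (0 : ℝ) 1, HasDerivAt w₁ (w₂ z) z
  d₂ : ∀ z ∈ Ioo (0 : ℝ) 1, HasDerivAt w₂ (w₃ z) z
  d₃ : ∀ z ∈ Ioo (0 : ℝ) 1, HasDerivAt w₃ (2 * κ * w₂ z - κ ^ 2 * w₀ z + R * κ * f z) z
  bot₀ : w₀ 0 = 0
  bot₁ : w₁ 0 = 0
  top₀ : w₀ 1 = 0
  top₁ : w₁ 1 = 0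

namespace ClampedMode

variable {κ R : ℝ} {w₀ w₁ w₂ w₃ f : ℝ → ℝ}

/-- Test the equation with `w₀`; the clamped ends remove all boundary terms. The factor κ of the
forcing is absorbed by the term κ² w₀², so the right-hand side does not depend on κ. -/
theorem energy (h : ClampedMode κ R w₀ w₁ w₂ w₃ f) (hκ : 0 ≤ κ) :
    (∫ z in (0 : ℝ)..1, w₂ z ^ 2) + 2⁻¹ * κ ^ 2 * (∫ z in (0 : ℝ)..1, w₀ z ^ 2)
      ≤ 2⁻¹ * R ^ 2 * ∫ z in (0 : ℝ)..1, f z ^ 2 := by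
  obtain ⟨c₀, c₁, c₂, c₃, cf, d₀, d₁, d₂, d₃, bot₀, bot₁, top₀, top₁⟩ := h
  have I : ∀ {g : ℝ → ℝ}, ContinuousOn g (Icc 0 1) → IntervalIntegrable g volume 0 1 :=
    fun hg => hg.intervalIntegrable_of_Icc zero_le_one
  have key : ∫ z in (0 : ℝ)..1,
      (-w₂ z ^ 2 - 2 * κ * w₁ z ^ 2 - κ ^ 2 * w₀ z ^ 2 + R * κ * f z * w₀ z) = 0 := by
    have := intervalIntegral.integral_eq_sub_of_hasDerivAt_of_le (zero_le_one' ℝ)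
      (f := fun z => w₃ z * w₀ z - w₂ z * w₁ z - 2 * κ * (w₁ z * w₀ z))
      (f' := fun z => -w₂ z ^ 2 - 2 * κ * w₁ z ^ 2 - κ ^ 2 * w₀ z ^ 2 + R * κ * f z * w₀ z)
      (by fun_prop) (fun z hz => by
        refine ((((d₃ z hz).mul (d₀ z hz)).sub ((d₂ z hz).mul (d₁ z hz))).sub
          (((d₁ z hz).mul (d₀ z hz)).const_mul (2 * κ))).congr_deriv ?_
        ring) (I (by fun_prop))
    simpa [bot₀, bot₁, top₀, top₁] using this
  have le : ∫ z in (0 : ℝ)..1,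
      (-w₂ z ^ 2 - 2 * κ * w₁ z ^ 2 - κ ^ 2 * w₀ z ^ 2 + R * κ * f z * w₀ z)
      ≤ ∫ z in (0 : ℝ)..1,
        (2⁻¹ * R ^ 2 * f z ^ 2 - w₂ z ^ 2 - 2⁻¹ * κ ^ 2 * w₀ z ^ 2) := by
    refine intervalIntegral.integral_mono_on zero_le_one (I (by fun_prop)) (I (by fun_prop)) ?_
    intro z _
    -- Young's inequality R κ f w₀ ≤ (κ² w₀² + R² f²)/2, with the term in `w₁` dropped.
    nlinarith [mul_nonneg hκ (sq_nonneg (w₁ z)), sq_nonneg (κ * w₀ z - R * f z)]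
  rw [key, intervalIntegral.integral_sub (I (by fun_prop)) (I (by fun_prop)),
    intervalIntegral.integral_sub (I (by fun_prop)) (I (by fun_prop)),
    intervalIntegral.integral_const_mul, intervalIntegral.integral_const_mul] at le
  linarith

theorem sq_second_le (h : ClampedMode κ R w₀ w₁ w₂ w₃ f) (hκ : 0 ≤ κ) :
    (∫ z in (0 : ℝ)..1, w₂ z ^ 2) ≤ 2⁻¹ * R ^ 2 * ∫ z in (0 : ℝ)..1, f z ^ 2 := by
  have := h.energy hκ
  have : 0 ≤ 2⁻¹ * κ ^ 2 * (∫ z in (0 : ℝ)..1, w₀ z ^ 2) :=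
    mul_nonneg (by positivity) (intervalIntegral.integral_nonneg zero_le_one fun _ _ => sq_nonneg _)
  linarith

theorem sq_zeroth_le (h : ClampedMode κ R w₀ w₁ w₂ w₃ f) (hκ : 0 ≤ κ) :
    κ ^ 2 * (∫ z in (0 : ℝ)..1, w₀ z ^ 2) ≤ R ^ 2 * ∫ z in (0 : ℝ)..1, f z ^ 2 := by
  have := h.energy hκ
  have : 0 ≤ (∫ z in (0 : ℝ)..1, w₂ z ^ 2) :=
    intervalIntegral.integral_nonneg zero_le_one fun _ _ => sq_nonneg _
  linarith

/-- The crude pointwise bound. -/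
theorem sq_le (h : ClampedMode κ R w₀ w₁ w₂ w₃ f) (hκ : 0 ≤ κ) {z : ℝ} (hz : z ∈ Icc (0 : ℝ) 1) :
    w₀ z ^ 2 ≤ R ^ 2 * ∫ z in (0 : ℝ)..1, f z ^ 2 := by
  have h2 := h.sq_second_le hκ
  have hnn : 0 ≤ (∫ z in (0 : ℝ)..1, w₂ z ^ 2) :=
    intervalIntegral.integral_nonneg zero_le_one fun _ _ => sq_nonneg _
  have h1 : ∫ z in (0 : ℝ)..1, w₁ z ^ 2 ≤ ∫ z in (0 : ℝ)..1, (∫ z in (0 : ℝ)..1, w₂ z ^ 2) := by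
    refine intervalIntegral.integral_mono_on zero_le_one
      ((h.c₁.pow 2).intervalIntegrable_of_Icc zero_le_one) (by simp) fun s hs => ?_
    refine (sq_le_of_hasDerivAt h.c₁ h.c₂ h.d₁ h.bot₁ hs).trans ?_
    exact mul_le_of_le_one_left hnn hs.2
  have h1' : 0 ≤ (∫ z in (0 : ℝ)..1, w₁ z ^ 2) :=
    intervalIntegral.integral_nonneg zero_le_one fun _ _ => sq_nonneg _
  have h0 := sq_le_of_hasDerivAt h.c₀ h.c₁ h.d₀ h.bot₀ hz
  have := mul_le_of_le_one_left h1' hz.2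
  simp only [intervalIntegral.integral_const, sub_zero, one_smul] at h1
  linarith

/-- A cubic cutoff on `[z, z + l]`, with its first two derivatives. -/
theorem exists_cutoff (z : ℝ) {l : ℝ} (hl0 : 0 < l) :
    ∃ q q1 q2 : ℝ → ℝ, Continuous q ∧ Continuous q1 ∧ Continuous q2 ∧
      (∀ s, HasDerivAt q (q1 s) s) ∧ (∀ s, HasDerivAt q1 (q2 s) s) ∧
      q z = 0 ∧ q1 z = 1 ∧ q (z + l) = 0 ∧ q1 (z + l) = 0 ∧
      ∀ s ∈ Icc z (z + l), q s ^ 2 ≤ l ^ 2 ∧ q2 s ^ 2 ≤ 16 / l ^ 2 := by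
  -- In the rescaled variable x = (s - z)/l this is l x (1 - x)²: unit slope at the left end, a
  -- double zero at the right end.
  refine ⟨fun s => (s - z) * (1 - (s - z) / l) ^ 2,
    fun s => (1 - (s - z) / l) ^ 2 - 2 * (s - z) / l * (1 - (s - z) / l),
    fun s => -4 / l + 6 * (s - z) / l ^ 2, by fun_prop, by fun_prop, by fun_prop,
    fun s => ?_, fun s => ?_, by simp, by simp, by simp [hl0.ne'], by simp [hl0.ne'],
    fun s hs => ?_⟩
  · have e : HasDerivAt (fun s => s - z) 1 s := (hasDerivAt_id s).sub_const z
    refine (e.mul (((e.div_const l).const_sub 1).pow 2)).congr_deriv ?_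
    simp only [Pi.pow_apply]; push_cast; ring
  · have e : HasDerivAt (fun s => s - z) 1 s := (hasDerivAt_id s).sub_const z
    have e2 := ((e.div_const l).const_sub 1)
    refine ((e2.pow 2).sub (((e.const_mul 2).div_const l).mul e2)).congr_deriv ?_
    push_cast; field_simp; ring
  · obtain ⟨x, hx⟩ : ∃ x, s - z = x * l := ⟨(s - z) / l, by field_simp⟩
    have hx0 : 0 ≤ x := by
      by_contra hneg; push Not at hneg
      nlinarith [hs.1, mul_pos_of_neg_of_neg hneg (neg_neg_of_pos hl0)]
    have hx1 : x ≤ 1 := by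
      by_contra hneg; push Not at hneg
      nlinarith [hs.2, mul_pos (sub_pos.2 hneg) hl0]
    have e1 : (s - z) * (1 - (s - z) / l) ^ 2 = l * (x * (1 - x) ^ 2) := by
      rw [hx]; field_simp
    have e2 : -4 / l + 6 * (s - z) / l ^ 2 = (6 * x - 4) / l := by
      rw [hx]; field_simp; ring
    simp only [e1, e2]
    constructor
    · rw [mul_pow]
      refine mul_le_of_le_one_right (sq_nonneg l) (pow_le_one₀ (by positivity) ?_)
      have : (1 - x) ^ 2 ≤ 1 := pow_le_one₀ (by linarith) (by linarith)
      nlinarith [sq_nonneg (1 - x)]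
    · rw [div_pow]
      gcongr
      nlinarith

/-- Integrating `w₃'` twice by parts against the cutoff on [z, z + l] represents `w₂ z` by the
right-hand side of the equation and `w₂` itself. Cauchy–Schwarz on an interval of length `l` then
gives a bound with `l` still free. -/
theorem sq_second_le_of_length (h : ClampedMode κ R w₀ w₁ w₂ w₃ f) {z l : ℝ} (hz : 0 ≤ z)
    (hl0 : 0 < l) (hzl : z + l ≤ 1) :
    w₂ z ^ 2 ≤ l * (4 * l ^ 2 * (4 * κ ^ 2 * (∫ z in (0 : ℝ)..1, w₂ z ^ 2)
      + κ ^ 4 * (∫ z in (0 : ℝ)..1, w₀ z ^ 2) + R ^ 2 * κ ^ 2 * (∫ z in (0 : ℝ)..1, f z ^ 2))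
      + 4 * (16 / l ^ 2) * (∫ z in (0 : ℝ)..1, w₂ z ^ 2)) := by
  obtain ⟨c₀, c₁, c₂, c₃, cf, d₀, d₁, d₂, d₃, bot₀, bot₁, top₀, top₁⟩ := h
  obtain ⟨q, q1, q2, cq, cq1, cq2, dq, dq1, qz, q1z, ql, q1l, qb⟩ := exists_cutoff z hl0
  have hsub : Icc z (z + l) ⊆ Icc (0 : ℝ) 1 := Icc_subset_Icc hz hzl
  have hle : z ≤ z + l := by linarith
  have cF : ContinuousOn (fun s => q s * (2 * κ * w₂ s - κ ^ 2 * w₀ s + R * κ * f s)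
      - q2 s * w₂ s) (Icc 0 1) := by fun_prop
  have cF' := cF.mono hsub
  -- Only the boundary term q'(z) w₂(z) survives, since q(z) = 0, q'(z) = 1 and both vanish at z +
  -- l.
  have rep : ∫ s in z..z + l, (q s * (2 * κ * w₂ s - κ ^ 2 * w₀ s + R * κ * f s)
      - q2 s * w₂ s) = w₂ z := by
    rw [intervalIntegral.integral_eq_sub_of_hasDerivAt_of_le hle
      (f := fun s => q s * w₃ s - q1 s * w₂ s)
      (ContinuousOn.mono (by fun_prop) hsub) (fun s hs => by
        have hs' : s ∈ Ioo (0 : ℝ) 1 := ⟨hz.trans_lt hs.1, hs.2.trans_le hzl⟩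
        refine (((dq s).mul (d₃ s hs')).sub ((dq1 s).mul (d₂ s hs'))).congr_deriv ?_
        ring) (cF'.intervalIntegrable_of_Icc hle)]
    simp [qz, q1z, ql, q1l]
  have Fb : ∀ s ∈ Icc z (z + l), (q s * (2 * κ * w₂ s - κ ^ 2 * w₀ s + R * κ * f s)
      - q2 s * w₂ s) ^ 2 ≤
      4 * l ^ 2 * (4 * κ ^ 2 * w₂ s ^ 2 + κ ^ 4 * w₀ s ^ 2 + R ^ 2 * κ ^ 2 * f s ^ 2)
        + 4 * (16 / l ^ 2) * w₂ s ^ 2 := by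
    intro s hs
    obtain ⟨b1, b2⟩ := qb s hs
    have four : ∀ a b c d : ℝ, (a - b + c - d) ^ 2 ≤ 4 * (a ^ 2 + b ^ 2 + c ^ 2 + d ^ 2) := by
      intro a b c d
      nlinarith [sq_nonneg (a + b), sq_nonneg (a - c), sq_nonneg (a + d), sq_nonneg (b + c),
        sq_nonneg (b - d), sq_nonneg (c + d)]
    have e : q s * (2 * κ * w₂ s - κ ^ 2 * w₀ s + R * κ * f s) - q2 s * w₂ s
        = q s * (2 * κ * w₂ s) - q s * (κ ^ 2 * w₀ s) + q s * (R * κ * f s) - q2 s * w₂ s := by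
      ring
    rw [e]
    refine (four _ _ _ _).trans ?_
    have k1 := mul_le_mul_of_nonneg_right b1
      (show 0 ≤ 4 * κ ^ 2 * w₂ s ^ 2 + κ ^ 4 * w₀ s ^ 2 + R ^ 2 * κ ^ 2 * f s ^ 2 by positivity)
    have k2 := mul_le_mul_of_nonneg_right b2 (sq_nonneg (w₂ s))
    linear_combination 4 * k1 + 4 * k2
  have cB : ContinuousOn (fun s =>
      4 * l ^ 2 * (4 * κ ^ 2 * w₂ s ^ 2 + κ ^ 4 * w₀ s ^ 2 + R ^ 2 * κ ^ 2 * f s ^ 2)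
        + 4 * (16 / l ^ 2) * w₂ s ^ 2) (Icc 0 1) := by fun_prop
  have I : ∀ {g : ℝ → ℝ}, ContinuousOn g (Icc 0 1) → IntervalIntegrable g volume 0 1 :=
    fun hg => hg.intervalIntegrable_of_Icc zero_le_one
  rw [← rep]
  refine (sq_intervalIntegral_le hle cF').trans ?_
  rw [add_sub_cancel_left]
  refine mul_le_mul_of_nonneg_left ?_ hl0.le
  refine (intervalIntegral.integral_mono_on hle
    ((cF'.pow 2).intervalIntegrable_of_Icc hle)
    ((cB.mono hsub).intervalIntegrable_of_Icc hle) Fb).trans ?_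
  refine (intervalIntegral_mono_of_nonneg hz hle hzl cB
    (fun s => by positivity)).trans_eq ?_
  rw [intervalIntegral.integral_add (I (by fun_prop)) (I (by fun_prop)),
    intervalIntegral.integral_const_mul, intervalIntegral.integral_add (I (by fun_prop))
    (I (by fun_prop)), intervalIntegral.integral_add (I (by fun_prop)) (I (by fun_prop)),
    intervalIntegral.integral_const_mul, intervalIntegral.integral_const_mul,
    intervalIntegral.integral_const_mul, intervalIntegral.integral_const_mul]

/-- Pointwise bound for the second derivative in the lower half of the layer. -/
theorem sq_second_pointwise (h : ClampedMode κ R w₀ w₁ w₂ w₃ f) (hκ : 0 ≤ κ) {z : ℝ}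
    (hz : z ∈ Icc (0 : ℝ) (1 / 2)) :
    w₂ z ^ 2 ≤ 66 * (1 + κ) * (R ^ 2 * ∫ z in (0 : ℝ)..1, f z ^ 2) := by
  have hMnn : 0 ≤ R ^ 2 * ∫ z in (0 : ℝ)..1, f z ^ 2 := mul_nonneg (sq_nonneg _)
    (intervalIntegral.integral_nonneg zero_le_one fun _ _ => sq_nonneg _)
  have h2 := h.sq_second_le hκ
  have h0 := h.sq_zeroth_le hκ
  obtain ⟨r, hr0, hr1, hr2⟩ : ∃ r : ℝ, 0 < r ∧ 1 ≤ r ∧ r ^ 2 = 1 + κ :=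
    ⟨√(1 + κ), Real.sqrt_pos.2 (by linarith), Real.one_le_sqrt.2 (by linarith),
      Real.sq_sqrt (by linarith)⟩
  -- The length 1/(2√(1 + κ)) balances the terms l³κ² and 1/l, both then of order √(1 + κ). It is at
  -- most 1/2, so the interval stays in the layer.
  obtain ⟨l, hl0, hlr⟩ : ∃ l : ℝ, 0 < l ∧ l * r = 1 / 2 :=
    ⟨1 / (2 * r), by positivity, by field_simp⟩
  have hl1 : l ≤ 1 / 2 := by nlinarith
  have tot := h.sq_second_le_of_length hz.1 hl0 (by linarith [hz.2])
  generalize (∫ z in (0 : ℝ)..1, w₂ z ^ 2) = W₂ at *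
  generalize (∫ z in (0 : ℝ)..1, w₀ z ^ 2) = W₀ at *
  generalize (∫ z in (0 : ℝ)..1, f z ^ 2) = N at *
  refine tot.trans ?_
  have A : 4 * κ ^ 2 * W₂ + κ ^ 4 * W₀ + R ^ 2 * κ ^ 2 * N ≤ 4 * κ ^ 2 * (R ^ 2 * N) := by
    have a1 := mul_le_mul_of_nonneg_left h2 (sq_nonneg κ)
    have a2 := mul_le_mul_of_nonneg_left h0 (sq_nonneg κ)
    linear_combination 4 * a1 + a2
  have B : W₂ ≤ R ^ 2 * N / 2 := by linarith
  have C : l * (4 * l ^ 2 * (4 * κ ^ 2 * (R ^ 2 * N)) + 4 * (16 / l ^ 2) * (R ^ 2 * N / 2))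
      = (16 * (l ^ 3 * κ ^ 2) + 32 / l) * (R ^ 2 * N) := by field_simp; ring
  refine (mul_le_mul_of_nonneg_left (add_le_add (mul_le_mul_of_nonneg_left A (by positivity))
    (mul_le_mul_of_nonneg_left B (by positivity))) hl0.le).trans ?_
  rw [C]
  refine mul_le_mul_of_nonneg_right ?_ hMnn
  have e1 : 32 / l = 64 * r := by
    rw [div_eq_iff hl0.ne']; linear_combination -64 * hlr
  have e2 : l ^ 3 * κ ^ 2 ≤ r / 8 := by
    have : κ ^ 2 ≤ r ^ 4 := by
      have : r ^ 4 = (1 + κ) ^ 2 := by rw [← hr2]; ring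
      rw [this]; gcongr; linarith
    calc l ^ 3 * κ ^ 2 ≤ l ^ 3 * r ^ 4 := by gcongr
      _ = (l * r) ^ 3 * r := by ring
      _ = r / 8 := by rw [hlr]; ring
  -- The argument gives √(1 + κ); the weaker factor 1 + κ suffices and matches a full horizontal
  -- derivative.
  have e3 : r ≤ 1 + κ := by rw [← hr2]; nlinarith
  rw [e1]
  linarith

/-- The quadratic vanishing of `w₀` at the lower plate, with a constant that grows only like the
horizontal `H¹` weight of the mode. -/
theorem sq_le_pow_four (h : ClampedMode κ R w₀ w₁ w₂ w₃ f) (hκ : 0 ≤ κ) {z : ℝ}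
    (hz : z ∈ Icc (0 : ℝ) 1) :
    w₀ z ^ 2 ≤ 66 * R ^ 2 * z ^ 4 * ((1 + κ) * ∫ z in (0 : ℝ)..1, f z ^ 2) := by
  set M := R ^ 2 * ∫ z in (0 : ℝ)..1, f z ^ 2 with hM
  have hMnn : 0 ≤ M := mul_nonneg (sq_nonneg _)
    (intervalIntegral.integral_nonneg zero_le_one fun _ _ => sq_nonneg _)
  have goal_eq : 66 * R ^ 2 * z ^ 4 * ((1 + κ) * ∫ z in (0 : ℝ)..1, f z ^ 2)
      = z ^ 4 * (66 * (1 + κ) * M) := by rw [hM]; ring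
  rw [goal_eq]
  rcases le_total z (1 / 2) with hz2 | hz2
  · have S0 : 0 ≤ 66 * (1 + κ) * M := by positivity
    set S := √(66 * (1 + κ) * M) with hS
    have hSS : S ^ 2 = 66 * (1 + κ) * M := Real.sq_sqrt S0
    have hSnn : 0 ≤ S := Real.sqrt_nonneg _
    -- Mean value theorem from the plate; used twice, from `w₂` to `w₁` and from `w₁` to `w₀`.
    have step : ∀ {u v : ℝ → ℝ} {K : ℝ}, 0 ≤ K → ContinuousOn u (Icc 0 1) →
        (∀ s ∈ Ioo (0 : ℝ) 1, HasDerivAt u (v s) s) → u 0 = 0 →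
        ∀ {y : ℝ}, y ∈ Icc (0 : ℝ) (1 / 2) → (∀ s ∈ Ioo (0 : ℝ) y, |v s| ≤ K) → |u y| ≤ K * y := by
      intro u v K hK cu du hu y hy hb
      rcases hy.1.eq_or_lt with rfl | hy0
      · simp [hu]
      obtain ⟨c, hc, e⟩ := exists_hasDerivAt_eq_slope u v hy0
        (cu.mono (Icc_subset_Icc_right (by linarith [hy.2])))
        (fun s hs => du s ⟨hs.1, by linarith [hs.2, hy.2]⟩)
      rw [hu, sub_zero, sub_zero] at e
      have : u y = v c * y := by rw [e]; field_simp
      rw [this, abs_mul, abs_of_pos hy0]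
      exact mul_le_mul_of_nonneg_right (hb c hc) hy0.le
    have b1 : ∀ y ∈ Icc (0 : ℝ) (1 / 2), |w₁ y| ≤ S * y := fun y hy =>
      step hSnn h.c₁ h.d₁ h.bot₁ hy fun s hs => by
        refine abs_le_of_sq_le_sq ?_ hSnn
        rw [hSS]
        exact h.sq_second_pointwise hκ ⟨hs.1.le, hs.2.le.trans hy.2⟩
    have b0 : |w₀ z| ≤ (S * z) * z :=
      step (mul_nonneg hSnn hz.1) h.c₀ h.d₀ h.bot₀ ⟨hz.1, hz2⟩ fun s hs =>
        (b1 s ⟨hs.1.le, hs.2.le.trans hz2⟩).trans (mul_le_mul_of_nonneg_left hs.2.le hSnn)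
    calc w₀ z ^ 2 = |w₀ z| ^ 2 := (sq_abs _).symm
      _ ≤ ((S * z) * z) ^ 2 := by gcongr
      _ = z ^ 4 * S ^ 2 := by ring
      _ = _ := by rw [hSS]
  -- Away from the lower plate z⁴ ≥ 1/16, and 66/16 ≥ 1, so the crude bound is enough.
  · have h1 := h.sq_le hκ hz
    rw [← hM] at h1
    have : (1 / 16 : ℝ) ≤ z ^ 4 := by
      calc (1 / 16 : ℝ) = (1 / 2) ^ 4 := by norm_num
        _ ≤ z ^ 4 := by gcongr
    have h3 : (1 / 16 : ℝ) * (66 * M) ≤ z ^ 4 * (66 * (1 + κ) * M) := by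
      refine mul_le_mul this ?_ (by positivity) (by positivity)
      nlinarith
    linarith

end ClampedMode

/-! ### Integrals depending on a parameter -/

/-- A function continuous on `S × K` with `K` compact is locally bounded in the parameter,
uniformly over `K`. -/
theorem eventually_bound_of_continuousOn {X Y E : Type*} [TopologicalSpace X]
    [TopologicalSpace Y] [SeminormedAddGroup E] {S : Set X} {K : Set Y} {f : X → Y → E}
    (hK : IsCompact K) (hf : ContinuousOn (Function.uncurry f) (S ×ˢ K)) {x₀ : X} (hx₀ : x₀ ∈ S) :
    ∃ B : ℝ, ∀ᶠ x in 𝓝[S] x₀, ∀ y ∈ K, ‖f x y‖ ≤ B := by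
  obtain ⟨B, hB⟩ := hK.exists_bound_of_continuousOn (f := f x₀)
    (hf.comp (f := fun y => (x₀, y)) (by fun_prop) fun y hy => ⟨hx₀, hy⟩)
  refine ⟨B + 1, ?_⟩
  -- Tube lemma: the local bounds near each (x₀, y) hold simultaneously for all y in `K`.
  have := hK.eventually_forall_of_forall_eventually (x₀ := x₀)
    (P := fun x y => x ∈ S → y ∈ K → ‖f x y‖ ≤ B + 1) fun y hy => by
      have h1 := (hf (x₀, y) ⟨hx₀, hy⟩).norm.eventually_lt_const
        (show ‖Function.uncurry f (x₀, y)‖ < B + 1 by have := hB y hy; simp; linarith)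
      rw [eventually_nhdsWithin_iff] at h1
      filter_upwards [h1] with z hz h1 h2
      exact (hz ⟨h1, h2⟩).le
  rw [eventually_nhdsWithin_iff]
  filter_upwards [this] with x hx hxS y hy using hx y hy hxS hy

section Parametric

variable {X Y E : Type*} [TopologicalSpace X] [FirstCountableTopology X] [TopologicalSpace Y]
  [T2Space Y] [MeasurableSpace Y]
  [OpensMeasurableSpace Y] [NormedAddCommGroup E] [NormedSpace ℝ E]

/-- Continuity of integrals over a compact set with respect to a parameter. -/
theorem continuousOn_setIntegral {μ : Measure Y} [IsFiniteMeasureOnCompacts μ]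
    {S : Set X} {K : Set Y} {f : X → Y → E}
    (hK : IsCompact K) (hf : ContinuousOn (Function.uncurry f) (S ×ˢ K)) :
    ContinuousOn (fun x => ∫ y in K, f x y ∂μ) S := by
  intro x₀ hx₀
  obtain ⟨B, hB⟩ := eventually_bound_of_continuousOn hK hf hx₀
  have slice : ∀ x ∈ S, ContinuousOn (f x) K := fun x hx =>
    hf.comp (f := fun y => (x, y)) (by fun_prop) fun y hy => ⟨hx, hy⟩
  refine continuousWithinAt_of_dominated (bound := fun _ => B) ?_ ?_ ?_ ?_
  · filter_upwards [self_mem_nhdsWithin] with x hx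
    exact (slice x hx).aestronglyMeasurable_of_isCompact hK hK.measurableSet
  · filter_upwards [hB] with x hx
    exact (ae_restrict_iff' hK.measurableSet).2 (.of_forall hx)
  · exact integrableOn_const hK.measure_lt_top.ne
  · refine (ae_restrict_iff' hK.measurableSet).2 (.of_forall fun y hy => ?_)
    exact (hf (x₀, y) ⟨hx₀, hy⟩).comp (f := fun x => (x, y))
      (by fun_prop) fun x hx => ⟨hx, hy⟩

/-- Differentiation of integrals over a compact set with respect to a real parameter. -/
theorem hasDerivAt_setIntegral {μ : Measure Y} [IsFiniteMeasureOnCompacts μ]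
    {S : Set ℝ} {K : Set Y} {f f' : ℝ → Y → E} (hS : IsOpen S)
    (hK : IsCompact K) (hf : ContinuousOn (Function.uncurry f) (S ×ˢ K))
    (hf' : ContinuousOn (Function.uncurry f') (S ×ˢ K))
    (hd : ∀ t ∈ S, ∀ y ∈ K, HasDerivAt (fun s => f s y) (f' t y) t) {t : ℝ} (ht : t ∈ S) :
    HasDerivAt (fun s => ∫ y in K, f s y ∂μ) (∫ y in K, f' t y ∂μ) t := by
  obtain ⟨B, hB⟩ := eventually_bound_of_continuousOn hK hf' ht
  have slice : ∀ {g : ℝ → Y → E}, ContinuousOn (Function.uncurry g) (S ×ˢ K) →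
      ∀ x ∈ S, ContinuousOn (g x) K := fun hg x hx =>
    hg.comp (f := fun y => (x, y)) (by fun_prop) fun y hy => ⟨hx, hy⟩
  rw [hS.nhdsWithin_eq ht] at hB
  refine (hasDerivAt_integral_of_dominated_loc_of_deriv_le (bound := fun _ => B)
    (F' := f') (inter_mem hB (hS.mem_nhds ht)) ?_ ?_ ?_ ?_ ?_ ?_).2
  · filter_upwards [hS.mem_nhds ht] with x hx
    exact (slice hf x hx).aestronglyMeasurable_of_isCompact hK hK.measurableSet
  · exact (slice hf t ht).integrableOn_compact hK
  · exact (slice hf' t ht).aestronglyMeasurable_of_isCompact hK hK.measurableSet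
  · exact (ae_restrict_iff' hK.measurableSet).2 (.of_forall fun y hy x hx => hx.1 y hy)
  · exact integrableOn_const hK.measure_lt_top.ne
  · exact (ae_restrict_iff' hK.measurableSet).2 (.of_forall fun y hy x hx => hd x hx.2 y hy)

end Parametric

/-! ### Parseval's identity on a rectangle -/

/-- The horizontal periodicity rectangle. -/
def rect (Lx Ly : ℝ) : Set (ℝ × ℝ) := Icc 0 Lx ×ˢ Icc 0 Ly

theorem isCompact_rect (Lx Ly : ℝ) : IsCompact (rect Lx Ly) := isCompact_Icc.prod isCompact_Icc

/-- The wave number of the `m`-th Fourier mode of period `L`. -/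
def wave (L : ℝ) (m : ℤ) : ℝ := 2 * Real.pi * m / L

/-- The phase of a horizontal Fourier mode. -/
def phase (Lx Ly : ℝ) (k : ℤ × ℤ) (r : ℝ × ℝ) : ℝ := wave Lx k.1 * r.1 + wave Ly k.2 * r.2

theorem continuous_phase (Lx Ly : ℝ) (k : ℤ × ℤ) : Continuous (phase Lx Ly k) := by
  unfold phase; fun_prop

theorem setIntegral_rect {E : Type*} [NormedAddCommGroup E] [NormedSpace ℝ E] {Lx Ly : ℝ}
    (hx : 0 < Lx) (hy : 0 < Ly) {g : ℝ × ℝ → E} (hg : ContinuousOn g (rect Lx Ly)) :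
    ∫ r in rect Lx Ly, g r = ∫ y in (0 : ℝ)..Ly, ∫ x in (0 : ℝ)..Lx, g (x, y) := by
  have hg' : ContinuousOn (g ∘ Prod.swap) (Icc 0 Ly ×ˢ Icc 0 Lx) :=
    hg.comp continuous_swap.continuousOn fun r hr => ⟨hr.2, hr.1⟩
  unfold rect
  rw [Measure.volume_eq_prod, ← setIntegral_prod_swap, setIntegral_prod (fun z => g z.swap)
    (hg'.integrableOn_compact (isCompact_Icc.prod isCompact_Icc)),
    intervalIntegral.integral_of_le hy.le, integral_Icc_eq_integral_Ioc]
  simp only [intervalIntegral.integral_of_le hx.le, integral_Icc_eq_integral_Ioc, Prod.swap]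

theorem memLp_of_continuousOn_Icc {a b : ℝ} {f : ℝ → ℂ} (hf : ContinuousOn f (Icc a b)) :
    MemLp f 2 (volume.restrict (Ioc a b)) := by
  obtain ⟨C, hC⟩ := isCompact_Icc.exists_bound_of_continuousOn hf
  exact MemLp.of_bound ((hf.mono Ioc_subset_Icc_self).aestronglyMeasurable measurableSet_Ioc) C
    ((ae_restrict_iff' measurableSet_Ioc).2 (.of_forall fun x hx => hC x (Ioc_subset_Icc_self hx)))

theorem fourierCoeffOn_zero_eq {L : ℝ} (hL : 0 < L) (f : ℝ → ℂ) (n : ℤ) :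
    fourierCoeffOn hL f n
      = (L : ℂ)⁻¹ * ∫ x in (0 : ℝ)..L, Complex.exp (-(wave L n * x : ℝ) * Complex.I) * f x := by
  rw [fourierCoeffOn_eq_integral]
  simp only [sub_zero, one_div, smul_eq_mul, fourier_coe_apply, Complex.real_smul]
  push_cast
  congr 2
  funext x
  congr 2
  simp only [wave]
  push_cast
  ring

/-- **Parseval's identity** for real continuous functions on a rectangle. -/
theorem hasSum_sq_rect {Lx Ly : ℝ} (hx : 0 < Lx) (hy : 0 < Ly) {g : ℝ × ℝ → ℝ}
    (hg : ContinuousOn g (rect Lx Ly)) :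
    HasSum (fun k : ℤ × ℤ => (Lx * Ly)⁻¹ *
      ((∫ r in rect Lx Ly, Real.cos (phase Lx Ly k r) * g r) ^ 2
        + (∫ r in rect Lx Ly, Real.sin (phase Lx Ly k r) * g r) ^ 2))
      (∫ r in rect Lx Ly, g r ^ 2) := by
  -- Partial coefficients in x. The one-dimensional identity is applied in x for each y, then in y
  -- to each `F m`.
  set F : ℤ → ℝ → ℂ := fun m y => fourierCoeffOn hx (fun x => (g (x, y) : ℂ)) m with hF
  have slice : ∀ y ∈ Icc (0 : ℝ) Ly, ContinuousOn (fun x => (g (x, y) : ℂ)) (Icc 0 Lx) :=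
    fun y hy' => Complex.continuous_ofReal.comp_continuousOn
      (hg.comp (f := fun x => (x, y)) (by fun_prop) fun x hx' => ⟨hx', hy'⟩)
  have cF : ∀ m, ContinuousOn (F m) (Icc 0 Ly) := by
    intro m
    simp only [hF, fourierCoeffOn_zero_eq, intervalIntegral.integral_of_le hx.le,
      ← integral_Icc_eq_integral_Ioc]
    refine continuousOn_const.mul (continuousOn_setIntegral isCompact_Icc ?_)
    refine ContinuousOn.mul (by fun_prop) (Complex.continuous_ofReal.comp_continuousOn ?_)
    exact hg.comp (f := fun r : ℝ × ℝ => (r.2, r.1)) (by fun_prop) fun r hr => ⟨hr.2, hr.1⟩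
  have s1 : ∀ y ∈ Icc (0 : ℝ) Ly, HasSum (fun m => ‖F m y‖ ^ 2)
      (Lx⁻¹ * ∫ x in (0 : ℝ)..Lx, g (x, y) ^ 2) := fun y hy' => by
    have := hasSum_sq_fourierCoeffOn hx (memLp_of_continuousOn_Icc (slice y hy'))
    simpa using this
  have s2 : ∀ m, HasSum (fun n => ‖fourierCoeffOn hy (F m) n‖ ^ 2)
      (Ly⁻¹ * ∫ y in (0 : ℝ)..Ly, ‖F m y‖ ^ 2) := fun m => by
    have := hasSum_sq_fourierCoeffOn hy (memLp_of_continuousOn_Icc (cF m))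
    simpa using this
  have cg2 : ContinuousOn (fun r => g r ^ 2) (rect Lx Ly) := hg.pow 2
  have cI : ContinuousOn (fun y => Lx⁻¹ * ∫ x in (0 : ℝ)..Lx, g (x, y) ^ 2) (Icc 0 Ly) := by
    simp only [intervalIntegral.integral_of_le hx.le, ← integral_Icc_eq_integral_Ioc]
    refine continuousOn_const.mul (continuousOn_setIntegral isCompact_Icc ?_)
    exact cg2.comp (f := fun r : ℝ × ℝ => (r.2, r.1)) (by fun_prop) fun r hr => ⟨hr.2, hr.1⟩
  have uIcc_sub : uIoc (0 : ℝ) Ly ⊆ Icc 0 Ly := by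
    rw [uIoc_of_le hy.le]; exact Ioc_subset_Icc_self
  -- The sum over m is integrated in y; the dominating function is the sum itself, a continuous
  -- function of y by Parseval in x.
  have s3 : HasSum (fun m => ∫ y in (0 : ℝ)..Ly, ‖F m y‖ ^ 2)
      (∫ y in (0 : ℝ)..Ly, Lx⁻¹ * ∫ x in (0 : ℝ)..Lx, g (x, y) ^ 2) := by
    refine intervalIntegral.hasSum_integral_of_dominated_convergence (fun m y => ‖F m y‖ ^ 2)
      (fun m => ?_) (fun m => .of_forall fun y _ => by simp)
      (.of_forall fun y hy' => (s1 y (uIcc_sub hy')).summable) ?_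
      (.of_forall fun y hy' => s1 y (uIcc_sub hy'))
    · rw [uIoc_of_le hy.le]
      exact (((cF m).norm.pow 2).mono Ioc_subset_Icc_self).aestronglyMeasurable measurableSet_Ioc
    · refine (cI.intervalIntegrable_of_Icc hy.le).congr fun y hy' => ?_
      exact (s1 y (uIcc_sub hy')).tsum_eq.symm
  have s4 : HasSum (fun m => Ly⁻¹ * ∫ y in (0 : ℝ)..Ly, ‖F m y‖ ^ 2)
      (Ly⁻¹ * (Lx⁻¹ * ∫ r in rect Lx Ly, g r ^ 2)) := by
    rw [setIntegral_rect hx hy cg2, ← intervalIntegral.integral_const_mul]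
    exact s3.mul_left _
  have sum : Summable (fun k : ℤ × ℤ => ‖fourierCoeffOn hy (F k.1) k.2‖ ^ 2) := by
    refine (summable_prod_of_nonneg fun _ => by positivity).2 ⟨fun m => (s2 m).summable, ?_⟩
    simp only [fun m => (s2 m).tsum_eq]
    exact s4.summable
  have tot : HasSum (fun k : ℤ × ℤ => ‖fourierCoeffOn hy (F k.1) k.2‖ ^ 2)
      (Ly⁻¹ * (Lx⁻¹ * ∫ r in rect Lx Ly, g r ^ 2)) := by
    have e := (sum.hasSum.prod_fiberwise s2).unique s4
    rw [← e]
    exact sum.hasSum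
  have final := tot.mul_left (Lx * Ly)
  have e1 : Lx * Ly * (Ly⁻¹ * (Lx⁻¹ * ∫ r in rect Lx Ly, g r ^ 2))
      = ∫ r in rect Lx Ly, g r ^ 2 := by field_simp
  rw [e1] at final
  refine final.congr_fun fun k => ?_
  have ci : ContinuousOn (fun r => Complex.exp (-(phase Lx Ly k r : ℝ) * Complex.I) * (g r : ℂ))
      (rect Lx Ly) :=
    ContinuousOn.mul (by have := continuous_phase Lx Ly k; fun_prop)
      (Complex.continuous_ofReal.comp_continuousOn hg)
  have e2 : fourierCoeffOn hy (F k.1) k.2 = ((Lx * Ly : ℝ) : ℂ)⁻¹ *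
      ∫ r in rect Lx Ly, Complex.exp (-(phase Lx Ly k r : ℝ) * Complex.I) * (g r : ℂ) := by
    rw [setIntegral_rect hx hy ci, fourierCoeffOn_zero_eq]
    simp only [hF, fourierCoeffOn_zero_eq]
    rw [← intervalIntegral.integral_const_mul, ← intervalIntegral.integral_const_mul]
    refine intervalIntegral.integral_congr fun y _ => ?_
    simp only [← intervalIntegral.integral_const_mul]
    refine intervalIntegral.integral_congr fun x _ => ?_
    simp only [phase]
    rw [show (-((wave Lx k.1 * x + wave Ly k.2 * y : ℝ) : ℂ) * Complex.I)
      = -(wave Ly k.2 * y : ℝ) * Complex.I + -(wave Lx k.1 * x : ℝ) * Complex.I by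
        push_cast; ring, Complex.exp_add]
    push_cast
    ring
  have cc : ContinuousOn (fun r => Real.cos (phase Lx Ly k r) * g r) (rect Lx Ly) :=
    ContinuousOn.mul (by have := continuous_phase Lx Ly k; fun_prop) hg
  have cs : ContinuousOn (fun r => Real.sin (phase Lx Ly k r) * g r) (rect Lx Ly) :=
    ContinuousOn.mul (by have := continuous_phase Lx Ly k; fun_prop) hg
  have e3 : ∫ r in rect Lx Ly, Complex.exp (-(phase Lx Ly k r : ℝ) * Complex.I) * (g r : ℂ)
      = ((∫ r in rect Lx Ly, Real.cos (phase Lx Ly k r) * g r : ℝ) : ℂ)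
        - ((∫ r in rect Lx Ly, Real.sin (phase Lx Ly k r) * g r : ℝ) : ℂ) * Complex.I := by
    rw [← integral_complex_ofReal, ← integral_complex_ofReal, ← integral_mul_const,
      ← integral_sub]
    · refine integral_congr_ae (.of_forall fun r => ?_)
      simp only
      rw [← Complex.ofReal_neg, Complex.exp_mul_I, ← Complex.ofReal_cos, ← Complex.ofReal_sin,
        Real.cos_neg, Real.sin_neg]
      push_cast; ring
    · exact (Complex.continuous_ofReal.comp_continuousOn cc).integrableOn_compact
        (isCompact_rect _ _)
    · exact ((Complex.continuous_ofReal.comp_continuousOn cs).integrableOn_compact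
        (isCompact_rect _ _)).mul_const _
  have e4 : ∀ a b : ℝ, ‖(a : ℂ) - (b : ℂ) * Complex.I‖ ^ 2 = a ^ 2 + b ^ 2 := fun a b => by
    rw [← Complex.normSq_eq_norm_sq, Complex.normSq_apply]; simp; ring
  rw [e2, e3, norm_mul, mul_pow, e4, norm_inv, Complex.norm_real,
    Real.norm_of_nonneg (by positivity)]
  field_simp

/-! ### Derivatives up to the plates -/

/-- The derivative in `x` within the closed layer. -/
def Dx (f : Pt → ℝ) (q : Pt) : ℝ := fderivWithin ℝ f slab q (1, 0, 0)

/-- The derivative in `y` within the closed layer. -/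
def Dy (f : Pt → ℝ) (q : Pt) : ℝ := fderivWithin ℝ f slab q (0, 1, 0)

/-- The derivative in `z` within the closed layer. -/
def Dz (f : Pt → ℝ) (q : Pt) : ℝ := fderivWithin ℝ f slab q (0, 0, 1)

theorem slab_eq : slab = univ ×ˢ univ ×ˢ Icc (0 : ℝ) 1 := by
  ext ⟨x, y, z⟩; simp [slab]

theorem uniqueDiffOn_slab : UniqueDiffOn ℝ slab := by
  rw [slab_eq]
  exact uniqueDiffOn_univ.prod (uniqueDiffOn_univ.prod (uniqueDiffOn_Icc zero_lt_one))

theorem openSlab_subset_slab : openSlab ⊆ slab := fun _ hq => ⟨hq.1.le, hq.2.le⟩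

theorem contDiffOn_Dx {f : Pt → ℝ} (hf : ContDiffOn ℝ 2 f slab) : ContDiffOn ℝ 1 (Dx f) slab :=
  (hf.fderivWithin uniqueDiffOn_slab (m := 1) (by norm_num)).clm_apply contDiffOn_const

theorem contDiffOn_Dy {f : Pt → ℝ} (hf : ContDiffOn ℝ 2 f slab) : ContDiffOn ℝ 1 (Dy f) slab :=
  (hf.fderivWithin uniqueDiffOn_slab (m := 1) (by norm_num)).clm_apply contDiffOn_const

theorem contDiffOn_Dz {f : Pt → ℝ} (hf : ContDiffOn ℝ 2 f slab) : ContDiffOn ℝ 1 (Dz f) slab :=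
  (hf.fderivWithin uniqueDiffOn_slab (m := 1) (by norm_num)).clm_apply contDiffOn_const

theorem continuousOn_Dx {f : Pt → ℝ} (hf : ContDiffOn ℝ 1 f slab) : ContinuousOn (Dx f) slab :=
  (hf.continuousOn_fderivWithin uniqueDiffOn_slab le_rfl).clm_apply continuousOn_const

theorem continuousOn_Dy {f : Pt → ℝ} (hf : ContDiffOn ℝ 1 f slab) : ContinuousOn (Dy f) slab :=
  (hf.continuousOn_fderivWithin uniqueDiffOn_slab le_rfl).clm_apply continuousOn_const

theorem continuousOn_Dz {f : Pt → ℝ} (hf : ContDiffOn ℝ 1 f slab) : ContinuousOn (Dz f) slab :=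
  (hf.continuousOn_fderivWithin uniqueDiffOn_slab le_rfl).clm_apply continuousOn_const

section Lines

variable {f : Pt → ℝ}

theorem hasFDerivWithinAt_slab (hf : ContDiffOn ℝ 1 f slab) {q : Pt} (hq : q ∈ slab) :
    HasFDerivWithinAt f (fderivWithin ℝ f slab q) slab q :=
  ((hf.differentiableOn one_ne_zero) q hq).hasFDerivWithinAt

theorem hasDerivAt_Dx (hf : ContDiffOn ℝ 1 f slab) {x y z : ℝ} (hz : z ∈ Icc (0 : ℝ) 1) :
    HasDerivAt (fun s => f (s, y, z)) (Dx f (x, y, z)) x :=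
  (hasFDerivWithinAt_slab hf (q := (x, y, z)) hz).comp_hasDerivAt (f := fun s : ℝ => (s, y, z)) x
    ((hasDerivAt_id x).prodMk ((hasDerivAt_const x y).prodMk (hasDerivAt_const x z)))
    (.of_forall fun _ => hz)

theorem hasDerivAt_Dy (hf : ContDiffOn ℝ 1 f slab) {x y z : ℝ} (hz : z ∈ Icc (0 : ℝ) 1) :
    HasDerivAt (fun s => f (x, s, z)) (Dy f (x, y, z)) y :=
  (hasFDerivWithinAt_slab hf (q := (x, y, z)) hz).comp_hasDerivAt (f := fun s : ℝ => (x, s, z)) y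
    ((hasDerivAt_const y x).prodMk ((hasDerivAt_id y).prodMk (hasDerivAt_const y z)))
    (.of_forall fun _ => hz)

theorem hasDerivAt_Dz (hf : ContDiffOn ℝ 1 f slab) {x y z : ℝ} (hz : z ∈ Ioo (0 : ℝ) 1) :
    HasDerivAt (fun s => f (x, y, s)) (Dz f (x, y, z)) z :=
  (hasFDerivWithinAt_slab hf (q := (x, y, z)) (Ioo_subset_Icc_self hz)).comp_hasDerivAt
    (f := fun s : ℝ => (x, y, s)) z
    ((hasDerivAt_const z x).prodMk ((hasDerivAt_const z y).prodMk (hasDerivAt_id z)))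
    (by filter_upwards [isOpen_Ioo.mem_nhds hz] with s hs using Ioo_subset_Icc_self hs)

theorem dx_eq (hf : ContDiffOn ℝ 1 f slab)
    {q : Pt} (hq : q ∈ slab) : dx f q = Dx f q := (hasDerivAt_Dx hf hq).deriv

theorem dy_eq (hf : ContDiffOn ℝ 1 f slab)
    {q : Pt} (hq : q ∈ slab) : dy f q = Dy f q := (hasDerivAt_Dy hf hq).deriv

theorem dz_eq (hf : ContDiffOn ℝ 1 f slab)
    {q : Pt} (hq : q ∈ openSlab) : dz f q = Dz f q := (hasDerivAt_Dz hf hq).deriv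

end Lines

/-- The inner derivatives must agree along the lines used by the outer ones. Horizontal lines stay
in the layer; for z, agreement near an interior point is enough. At the plates an ordinary
z-derivative would depend on values outside the layer. -/
theorem lap_eq {f : Pt → ℝ} (hf : ContDiffOn ℝ 2 f slab) {q : Pt} (hq : q ∈ openSlab) :
    lap f q = Dx (Dx f) q + Dy (Dy f) q + Dz (Dz f) q := by
  have h1 : ContDiffOn ℝ 1 f slab := hf.of_le (by norm_num)
  have hq' := openSlab_subset_slab hq
  rw [← dx_eq (contDiffOn_Dx hf) hq', ← dy_eq (contDiffOn_Dy hf) hq', ← dz_eq (contDiffOn_Dz hf) hq]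
  unfold lap
  congr 1
  · congr 1
    · unfold dx
      congr 1; funext s
      exact dx_eq h1 (q := (s, q.2.1, q.2.2)) hq'
    · unfold dy
      congr 1; funext s
      exact dy_eq h1 (q := (q.1, s, q.2.2)) hq'
  · refine Filter.EventuallyEq.deriv_eq ?_
    filter_upwards [isOpen_Ioo.mem_nhds (show q.2.2 ∈ Ioo (0 : ℝ) 1 from hq)] with s hs
    exact dz_eq h1 (q := (q.1, q.2.1, s)) hs

theorem HorizontallyPeriodic.Dx {Lx Ly : ℝ} {f : Pt → ℝ} (hf : ContDiffOn ℝ 1 f slab)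
    (hp : HorizontallyPeriodic Lx Ly f) : HorizontallyPeriodic Lx Ly (Dx f) := by
  intro x y z h0 h1
  constructor
  · have a := (hasDerivAt_Dx hf (x := x + Lx) (y := y) (z := z) ⟨h0, h1⟩).comp_add_const x Lx
    exact (a.congr_of_eventuallyEq (.of_forall fun s => (hp s y z h0 h1).1.symm)).unique
      (hasDerivAt_Dx hf ⟨h0, h1⟩)
  · have a := hasDerivAt_Dx hf (x := x) (y := y + Ly) (z := z) ⟨h0, h1⟩
    exact (a.congr_of_eventuallyEq (.of_forall fun s => (hp s y z h0 h1).2.symm)).unique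
      (hasDerivAt_Dx hf ⟨h0, h1⟩)

theorem HorizontallyPeriodic.Dy {Lx Ly : ℝ} {f : Pt → ℝ} (hf : ContDiffOn ℝ 1 f slab)
    (hp : HorizontallyPeriodic Lx Ly f) : HorizontallyPeriodic Lx Ly (Dy f) := by
  intro x y z h0 h1
  constructor
  · have a := hasDerivAt_Dy hf (x := x + Lx) (y := y) (z := z) ⟨h0, h1⟩
    exact (a.congr_of_eventuallyEq (.of_forall fun s => (hp x s z h0 h1).1.symm)).unique
      (hasDerivAt_Dy hf ⟨h0, h1⟩)
  · have a := (hasDerivAt_Dy hf (x := x) (y := y + Ly) (z := z) ⟨h0, h1⟩).comp_add_const y Ly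
    exact (a.congr_of_eventuallyEq (.of_forall fun s => (hp x s z h0 h1).2.symm)).unique
      (hasDerivAt_Dy hf ⟨h0, h1⟩)

/-! ### Integrals over slices and over the cell -/

theorem isCompact_cell (Lx Ly : ℝ) : IsCompact (cell Lx Ly) :=
  isCompact_Icc.prod (isCompact_Icc.prod isCompact_Icc)

theorem measurableSet_cell (Lx Ly : ℝ) : MeasurableSet (cell Lx Ly) :=
  (isCompact_cell Lx Ly).measurableSet

theorem cell_subset_slab (Lx Ly : ℝ) : cell Lx Ly ⊆ slab := fun _ hq => hq.2.2

theorem ContinuousOn.integrableOn_cell {Lx Ly : ℝ} {g : Pt → ℝ} (hg : ContinuousOn g slab) :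
    IntegrableOn g (cell Lx Ly) :=
  (hg.mono (cell_subset_slab Lx Ly)).integrableOn_compact (isCompact_cell Lx Ly)

/-- The integral of `f` over a horizontal slice of the cell. -/
def slice (Lx Ly : ℝ) (f : Pt → ℝ) (z : ℝ) : ℝ := ∫ r in rect Lx Ly, f (r.1, r.2, z)

theorem ContinuousOn.prodAssoc_slab {g : Pt → ℝ} (hg : ContinuousOn g slab) :
    ContinuousOn (fun p : (ℝ × ℝ) × ℝ => g (p.1.1, p.1.2, p.2)) (univ ×ˢ Icc (0 : ℝ) 1) :=
  hg.comp (f := fun p : (ℝ × ℝ) × ℝ => (p.1.1, p.1.2, p.2)) (by fun_prop) fun _ hp => hp.2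

theorem ContinuousOn.swap_slab {g : Pt → ℝ} (hg : ContinuousOn g slab) :
    ContinuousOn (fun p : ℝ × (ℝ × ℝ) => g (p.2.1, p.2.2, p.1)) (Icc (0 : ℝ) 1 ×ˢ univ) :=
  hg.comp (f := fun p : ℝ × (ℝ × ℝ) => (p.2.1, p.2.2, p.1)) (by fun_prop) fun _ hp => hp.1

theorem ContinuousOn.slice_slab {g : Pt → ℝ} (hg : ContinuousOn g slab) {z : ℝ}
    (hz : z ∈ Icc (0 : ℝ) 1) : Continuous (fun r : ℝ × ℝ => g (r.1, r.2, z)) :=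
  hg.comp_continuous (by fun_prop) fun _ => hz

theorem setIntegral_cell_prodAssoc {Lx Ly : ℝ} (g : Pt → ℝ) :
    ∫ q in cell Lx Ly, g q = ∫ p in rect Lx Ly ×ˢ Icc (0 : ℝ) 1, g (p.1.1, p.1.2, p.2) := by
  have hmp : MeasurePreserving (MeasurableEquiv.prodAssoc : (ℝ × ℝ) × ℝ ≃ᵐ ℝ × ℝ × ℝ) :=
    volume_preserving_prodAssoc
  have := hmp.setIntegral_preimage_emb MeasurableEquiv.prodAssoc.measurableEmbedding g
    (cell Lx Ly)
  rw [← this]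
  congr 2
  ext ⟨⟨x, y⟩, z⟩
  simp [cell, rect, MeasurableEquiv.prodAssoc, and_assoc]

theorem setIntegral_cell_vertical {Lx Ly : ℝ} {g : Pt → ℝ} (hg : ContinuousOn g slab) :
    ∫ q in cell Lx Ly, g q = ∫ r in rect Lx Ly, ∫ z in (0 : ℝ)..1, g (r.1, r.2, z) := by
  rw [setIntegral_cell_prodAssoc, Measure.volume_eq_prod, setIntegral_prod _
    (((ContinuousOn.prodAssoc_slab hg).mono (prod_mono_left (subset_univ _))).integrableOn_compact
      ((isCompact_rect Lx Ly).prod isCompact_Icc))]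
  simp only [intervalIntegral.integral_of_le zero_le_one, integral_Icc_eq_integral_Ioc]

theorem setIntegral_cell_slice {Lx Ly : ℝ} {g : Pt → ℝ} (hg : ContinuousOn g slab) :
    ∫ q in cell Lx Ly, g q = ∫ z in (0 : ℝ)..1, slice Lx Ly g z := by
  rw [setIntegral_cell_prodAssoc, Measure.volume_eq_prod, ← setIntegral_prod_swap,
    setIntegral_prod (fun z : ℝ × (ℝ × ℝ) => g (z.swap.1.1, z.swap.1.2, z.swap.2))
    (((ContinuousOn.swap_slab hg).mono (prod_mono_right (subset_univ _))).integrableOn_compact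
      (isCompact_Icc.prod (isCompact_rect Lx Ly)))]
  simp only [intervalIntegral.integral_of_le zero_le_one, integral_Icc_eq_integral_Ioc, slice,
    Prod.swap]

theorem continuousOn_slice {Lx Ly : ℝ} {g : Pt → ℝ} (hg : ContinuousOn g slab) :
    ContinuousOn (slice Lx Ly g) (Icc 0 1) :=
  continuousOn_setIntegral (f := fun z (r : ℝ × ℝ) => g (r.1, r.2, z)) (isCompact_rect Lx Ly)
    ((ContinuousOn.swap_slab hg).mono (prod_mono_right (subset_univ _)))

theorem hasDerivAt_slice {Lx Ly : ℝ} {g g' : Pt → ℝ} (hg : ContinuousOn g slab)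
    (hg' : ContinuousOn g' slab)
    (hd : ∀ x y, ∀ z ∈ Ioo (0 : ℝ) 1, HasDerivAt (fun s => g (x, y, s)) (g' (x, y, z)) z)
    {z : ℝ} (hz : z ∈ Ioo (0 : ℝ) 1) :
    HasDerivAt (slice Lx Ly g) (slice Lx Ly g' z) z :=
  hasDerivAt_setIntegral (f := fun z (r : ℝ × ℝ) => g (r.1, r.2, z))
    (f' := fun z (r : ℝ × ℝ) => g' (r.1, r.2, z)) isOpen_Ioo (isCompact_rect Lx Ly)
    ((ContinuousOn.swap_slab hg).mono (prod_mono Ioo_subset_Icc_self (subset_univ _)))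
    ((ContinuousOn.swap_slab hg').mono (prod_mono Ioo_subset_Icc_self (subset_univ _)))
    (fun z hz r _ => hd r.1 r.2 z hz) hz

/-- The integral of an `x`-derivative of a function with equal values at `0` and `Lx`. -/
theorem setIntegral_rect_deriv_x {Lx Ly : ℝ} (hx : 0 < Lx) (hy : 0 < Ly) {g g' : ℝ × ℝ → ℝ}
    (hg' : Continuous g') (hd : ∀ x y, HasDerivAt (fun s => g (s, y)) (g' (x, y)) x)
    (hp : ∀ y, g (Lx, y) = g (0, y)) : ∫ r in rect Lx Ly, g' r = 0 := by
  rw [setIntegral_rect hx hy hg'.continuousOn]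
  refine (intervalIntegral.integral_congr (g := fun _ => (0 : ℝ)) fun y _ => ?_).trans (by simp)
  simp only
  rw [intervalIntegral.integral_eq_sub_of_hasDerivAt (fun x _ => hd x y)
    (Continuous.intervalIntegrable (by fun_prop) _ _), hp, sub_self]

/-- The integral of a `y`-derivative of a function with equal values at `0` and `Ly`. -/
theorem setIntegral_rect_deriv_y {Lx Ly : ℝ} (hy : 0 < Ly) {g g' : ℝ × ℝ → ℝ}
    (hg' : Continuous g') (hd : ∀ x y, HasDerivAt (fun s => g (x, s)) (g' (x, y)) y)
    (hp : ∀ x, g (x, Ly) = g (x, 0)) : ∫ r in rect Lx Ly, g' r = 0 := by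
  unfold rect
  rw [Measure.volume_eq_prod, setIntegral_prod _ (hg'.continuousOn.integrableOn_compact
    (isCompact_Icc.prod isCompact_Icc))]
  refine (integral_congr_ae (g := fun _ => (0 : ℝ)) (.of_forall fun x => ?_)).trans (by simp)
  simp only
  rw [integral_Icc_eq_integral_Ioc, ← intervalIntegral.integral_of_le hy.le,
    intervalIntegral.integral_eq_sub_of_hasDerivAt (fun y _ => hd x y)
    (Continuous.intervalIntegrable (by fun_prop) _ _), hp, sub_self]

theorem HorizontallyPeriodic.at_x {Lx Ly : ℝ} {f : Pt → ℝ} (h : HorizontallyPeriodic Lx Ly f)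
    {y z : ℝ} (hz : z ∈ Icc (0 : ℝ) 1) : f (Lx, y, z) = f (0, y, z) := by
  simpa using (h 0 y z hz.1 hz.2).1

theorem HorizontallyPeriodic.at_y {Lx Ly : ℝ} {f : Pt → ℝ} (h : HorizontallyPeriodic Lx Ly f)
    {x z : ℝ} (hz : z ∈ Icc (0 : ℝ) 1) : f (x, Ly, z) = f (x, 0, z) := by
  simpa using (h x 0 z hz.1 hz.2).2

/-- **Divergence theorem** in the cell: a field that is horizontally periodic, with no vertical
component on the plates, has a divergence with zero integral. -/
theorem setIntegral_cell_div {Lx Ly : ℝ} (hx : 0 < Lx) (hy : 0 < Ly)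
    {V₁ V₂ V₃ V₁' V₂' V₃' : Pt → ℝ}
    (c₃ : ContinuousOn V₃ slab)
    (c₁' : ContinuousOn V₁' slab) (c₂' : ContinuousOn V₂' slab) (c₃' : ContinuousOn V₃' slab)
    (d₁ : ∀ x y, ∀ z ∈ Ioo (0 : ℝ) 1, HasDerivAt (fun s => V₁ (s, y, z)) (V₁' (x, y, z)) x)
    (d₂ : ∀ x y, ∀ z ∈ Ioo (0 : ℝ) 1, HasDerivAt (fun s => V₂ (x, s, z)) (V₂' (x, y, z)) y)
    (d₃ : ∀ x y, ∀ z ∈ Ioo (0 : ℝ) 1, HasDerivAt (fun s => V₃ (x, y, s)) (V₃' (x, y, z)) z)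
    (p₁ : HorizontallyPeriodic Lx Ly V₁) (p₂ : HorizontallyPeriodic Lx Ly V₂)
    (b : ∀ x y, V₃ (x, y, 0) = 0) (t : ∀ x y, V₃ (x, y, 1) = 0) :
    ∫ q in cell Lx Ly, (V₁' q + V₂' q + V₃' q) = 0 := by
  rw [integral_add (f := fun q => V₁' q + V₂' q) (ContinuousOn.integrableOn_cell (c₁'.add c₂'))
    (ContinuousOn.integrableOn_cell c₃'), integral_add (ContinuousOn.integrableOn_cell c₁')
    (ContinuousOn.integrableOn_cell c₂'), setIntegral_cell_slice c₁', setIntegral_cell_slice c₂',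
    setIntegral_cell_slice c₃']
  have z1 : ∫ z in (0 : ℝ)..1, slice Lx Ly V₁' z = 0 := by
    refine (intervalIntegral.integral_congr_ae (g := fun _ => (0 : ℝ)) ?_).trans (by simp)
    -- The interval integral runs over (0, 1]; removing the null set {1} leaves interior heights,
    -- where the derivatives are assumed.
    filter_upwards [compl_mem_ae_iff.2 (measure_singleton (1 : ℝ))] with z hz1 hz
    rw [uIoc_of_le zero_le_one] at hz
    have hz' : z ∈ Ioo (0 : ℝ) 1 := ⟨hz.1, lt_of_le_of_ne hz.2 hz1⟩
    exact setIntegral_rect_deriv_x hx hy (g := fun r => V₁ (r.1, r.2, z))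
      (ContinuousOn.slice_slab c₁' (Ioo_subset_Icc_self hz')) (fun x y => d₁ x y z hz')
      fun y => p₁.at_x (Ioo_subset_Icc_self hz')
  have z2 : ∫ z in (0 : ℝ)..1, slice Lx Ly V₂' z = 0 := by
    refine (intervalIntegral.integral_congr_ae (g := fun _ => (0 : ℝ)) ?_).trans (by simp)
    filter_upwards [compl_mem_ae_iff.2 (measure_singleton (1 : ℝ))] with z hz1 hz
    rw [uIoc_of_le zero_le_one] at hz
    have hz' : z ∈ Ioo (0 : ℝ) 1 := ⟨hz.1, lt_of_le_of_ne hz.2 hz1⟩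
    exact setIntegral_rect_deriv_y hy (g := fun r => V₂ (r.1, r.2, z))
      (ContinuousOn.slice_slab c₂' (Ioo_subset_Icc_self hz')) (fun x y => d₂ x y z hz')
      fun y => p₂.at_y (Ioo_subset_Icc_self hz')
  have z3 : ∫ z in (0 : ℝ)..1, slice Lx Ly V₃' z = 0 := by
    rw [intervalIntegral.integral_eq_sub_of_hasDerivAt_of_le zero_le_one (continuousOn_slice c₃)
      (fun z hz => hasDerivAt_slice c₃ c₃' d₃ hz)
      ((continuousOn_slice c₃').intervalIntegrable_of_Icc zero_le_one)]
    simp [slice, b, t]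
  rw [z1, z2, z3]; simp

/-- Almost every point of the cell lies in the open layer. -/
theorem ae_mem_openSlab (Lx Ly : ℝ) : ∀ᵐ q ∂(volume.restrict (cell Lx Ly)), q ∈ openSlab := by
  have hz : ∀ c : ℝ, ∀ᵐ q : Pt, q.2.2 ≠ c := fun c => by
    have : ({q : Pt | q.2.2 = c} : Set Pt) = univ ×ˢ univ ×ˢ {c} := by ext; simp
    rw [ae_iff]
    simp only [ne_eq, not_not]
    rw [this, Measure.volume_eq_prod, Measure.prod_prod, Measure.volume_eq_prod, Measure.prod_prod]
    simp
  rw [ae_restrict_iff' (measurableSet_cell Lx Ly)]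
  filter_upwards [hz 0, hz 1] with q h0 h1 hq
  exact ⟨lt_of_le_of_ne hq.2.2.1 h0.symm, lt_of_le_of_ne hq.2.2.2 h1⟩

/-! ### Horizontal Fourier modes -/

/-- The integral of `f` over a horizontal slice against the weight `ρ`. -/
def mode (Lx Ly : ℝ) (ρ : ℝ × ℝ → ℝ) (f : Pt → ℝ) (z : ℝ) : ℝ :=
  slice Lx Ly (fun q => ρ (q.1, q.2.1) * f q) z

/-- The cosine weight of wave vector `k`, shifted by `c`. -/
def cosW (Lx Ly : ℝ) (k : ℤ × ℤ) (c : ℝ) (r : ℝ × ℝ) : ℝ := Real.cos (phase Lx Ly k r + c)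

/-- The sine weight of wave vector `k`, shifted by `c`. -/
def sinW (Lx Ly : ℝ) (k : ℤ × ℤ) (c : ℝ) (r : ℝ × ℝ) : ℝ := Real.sin (phase Lx Ly k r + c)

section Mode

variable {Lx Ly : ℝ} {ρ : ℝ × ℝ → ℝ} {f g : Pt → ℝ} {z : ℝ}

theorem continuousOn_weight (hρ : Continuous ρ) (hf : ContinuousOn f slab) :
    ContinuousOn (fun q : Pt => ρ (q.1, q.2.1) * f q) slab :=
  ContinuousOn.mul (by fun_prop) hf

theorem continuousOn_mode (hρ : Continuous ρ) (hf : ContinuousOn f slab) :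
    ContinuousOn (mode Lx Ly ρ f) (Icc 0 1) :=
  continuousOn_slice (continuousOn_weight hρ hf)

theorem integrableOn_rect (hf : ContinuousOn f slab) (hz : z ∈ Icc (0 : ℝ) 1) :
    IntegrableOn (fun r : ℝ × ℝ => f (r.1, r.2, z)) (rect Lx Ly) :=
  (ContinuousOn.slice_slab hf hz).continuousOn.integrableOn_compact (isCompact_rect Lx Ly)

theorem mode_add (hρ : Continuous ρ) (hf : ContinuousOn f slab) (hg : ContinuousOn g slab)
    (hz : z ∈ Icc (0 : ℝ) 1) :
    mode Lx Ly ρ (fun q => f q + g q) z = mode Lx Ly ρ f z + mode Lx Ly ρ g z := by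
  unfold mode slice
  rw [← integral_add (integrableOn_rect (continuousOn_weight hρ hf) hz)
    (integrableOn_rect (continuousOn_weight hρ hg) hz)]
  simp only [mul_add]

theorem mode_const_mul (c : ℝ) : mode Lx Ly ρ (fun q => c * f q) z = c * mode Lx Ly ρ f z := by
  unfold mode slice
  rw [← integral_const_mul]
  congr 1; funext r; ring

theorem mode_congr (h : ∀ x y, f (x, y, z) = g (x, y, z)) :
    mode Lx Ly ρ f z = mode Lx Ly ρ g z := by
  simp only [mode, slice, h]

theorem mode_eq_zero (h : ∀ x y, f (x, y, z) = 0) : mode Lx Ly ρ f z = 0 := by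
  simp [mode, slice, h]

theorem hasDerivAt_mode (hρ : Continuous ρ) (hf : ContDiffOn ℝ 1 f slab)
    (hz : z ∈ Ioo (0 : ℝ) 1) : HasDerivAt (mode Lx Ly ρ f) (mode Lx Ly ρ (Dz f) z) z :=
  hasDerivAt_slice (continuousOn_weight hρ hf.continuousOn)
    (continuousOn_weight hρ (continuousOn_Dz hf))
    (fun x y _ hz => (hasDerivAt_Dz hf hz).const_mul (ρ (x, y))) hz

variable {k : ℤ × ℤ} {c : ℝ}

theorem continuous_cosW : Continuous (cosW Lx Ly k c) := by
  have := continuous_phase Lx Ly k; unfold cosW; fun_prop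

theorem continuous_sinW : Continuous (sinW Lx Ly k c) := by
  have := continuous_phase Lx Ly k; unfold sinW; fun_prop

/-- The phase shift lets one derivation of the clamped equation serve both real Fourier
coefficients. -/
theorem sinW_eq_cosW : sinW Lx Ly k 0 = cosW Lx Ly k (-(Real.pi / 2)) := by
  funext r
  rw [sinW, cosW, ← sub_eq_add_neg, Real.cos_sub_pi_div_two, add_zero]

theorem wave_mul_period {L : ℝ} (hL : 0 < L) (m : ℤ) : wave L m * L = m * (2 * Real.pi) := by
  unfold wave; field_simp

theorem hasDerivAt_phase_x (x y : ℝ) :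
    HasDerivAt (fun s => phase Lx Ly k (s, y) + c) (wave Lx k.1) x := by
  simpa only [id, mul_one, phase] using
    (((hasDerivAt_id x).const_mul (wave Lx k.1)).add_const (wave Ly k.2 * y)).add_const c

theorem hasDerivAt_phase_y (x y : ℝ) :
    HasDerivAt (fun s => phase Lx Ly k (x, s) + c) (wave Ly k.2) y := by
  simpa only [id, mul_one, phase] using
    (((hasDerivAt_id y).const_mul (wave Ly k.2)).const_add (wave Lx k.1 * x)).add_const c

theorem phase_period_x (hx : 0 < Lx) (y : ℝ) :
    phase Lx Ly k (Lx, y) + c = (phase Lx Ly k (0, y) + c) + k.1 * (2 * Real.pi) := by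
  simp only [phase, wave_mul_period hx]; ring

theorem phase_period_y (hy : 0 < Ly) (x : ℝ) :
    phase Lx Ly k (x, Ly) + c = (phase Lx Ly k (x, 0) + c) + k.2 * (2 * Real.pi) := by
  simp only [phase, wave_mul_period hy]; ring

/-- Integration by parts in `x` against a periodic weight. -/
theorem mode_Dx_of_weight (hx : 0 < Lx) (hy : 0 < Ly) {ρ ρ' : ℝ × ℝ → ℝ} (hρ : Continuous ρ)
    (hρ' : Continuous ρ') (hd : ∀ x y, HasDerivAt (fun s => ρ (s, y)) (ρ' (x, y)) x)
    (hp : ∀ y, ρ (Lx, y) = ρ (0, y)) (hf : ContDiffOn ℝ 1 f slab)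
    (hfp : HorizontallyPeriodic Lx Ly f) (hz : z ∈ Icc (0 : ℝ) 1) :
    mode Lx Ly ρ (Dx f) z = -mode Lx Ly ρ' f z := by
  have i1 := ContinuousOn.slice_slab (continuousOn_weight hρ' hf.continuousOn) hz
  have i2 := ContinuousOn.slice_slab (continuousOn_weight hρ (continuousOn_Dx hf)) hz
  have := setIntegral_rect_deriv_x hx hy (g := fun r => ρ r * f (r.1, r.2, z)) (i1.add i2)
    (fun x y => (hd x y).mul (hasDerivAt_Dx hf hz)) (fun y => by simp only [hp, hfp.at_x hz])
  rw [integral_add' (integrableOn_rect (continuousOn_weight hρ' hf.continuousOn) hz)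
    (integrableOn_rect (continuousOn_weight hρ (continuousOn_Dx hf)) hz)] at this
  unfold mode slice
  linarith

/-- Integration by parts in `y` against a periodic weight. -/
theorem mode_Dy_of_weight (hy : 0 < Ly) {ρ ρ' : ℝ × ℝ → ℝ} (hρ : Continuous ρ)
    (hρ' : Continuous ρ') (hd : ∀ x y, HasDerivAt (fun s => ρ (x, s)) (ρ' (x, y)) y)
    (hp : ∀ x, ρ (x, Ly) = ρ (x, 0)) (hf : ContDiffOn ℝ 1 f slab)
    (hfp : HorizontallyPeriodic Lx Ly f) (hz : z ∈ Icc (0 : ℝ) 1) :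
    mode Lx Ly ρ (Dy f) z = -mode Lx Ly ρ' f z := by
  have i1 := ContinuousOn.slice_slab (continuousOn_weight hρ' hf.continuousOn) hz
  have i2 := ContinuousOn.slice_slab (continuousOn_weight hρ (continuousOn_Dy hf)) hz
  have := setIntegral_rect_deriv_y (Lx := Lx) hy (g := fun r => ρ r * f (r.1, r.2, z)) (i1.add i2)
    (fun x y => (hd x y).mul (hasDerivAt_Dy hf hz)) (fun y => by simp only [hp, hfp.at_y hz])
  rw [integral_add' (integrableOn_rect (continuousOn_weight hρ' hf.continuousOn) hz)
    (integrableOn_rect (continuousOn_weight hρ (continuousOn_Dy hf)) hz)] at this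
  unfold mode slice
  linarith

theorem mode_weight_const_mul (d : ℝ) :
    mode Lx Ly (fun r => d * ρ r) f z = d * mode Lx Ly ρ f z := by
  unfold mode slice
  rw [← integral_const_mul]
  congr 1; funext r; ring

theorem mode_cosW_Dx (hx : 0 < Lx) (hy : 0 < Ly) (hf : ContDiffOn ℝ 1 f slab)
    (hfp : HorizontallyPeriodic Lx Ly f) (hz : z ∈ Icc (0 : ℝ) 1) :
    mode Lx Ly (cosW Lx Ly k c) (Dx f) z = wave Lx k.1 * mode Lx Ly (sinW Lx Ly k c) f z := by
  rw [mode_Dx_of_weight hx hy continuous_cosW (continuous_sinW.const_mul (-wave Lx k.1))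
    (fun x y => (hasDerivAt_phase_x x y).cos.congr_deriv (by simp only [sinW]; ring))
    (fun y => by rw [cosW, phase_period_x hx, Real.cos_add_int_mul_two_pi, cosW]) hf hfp hz,
    mode_weight_const_mul]
  ring

theorem mode_sinW_Dx (hx : 0 < Lx) (hy : 0 < Ly) (hf : ContDiffOn ℝ 1 f slab)
    (hfp : HorizontallyPeriodic Lx Ly f) (hz : z ∈ Icc (0 : ℝ) 1) :
    mode Lx Ly (sinW Lx Ly k c) (Dx f) z = -(wave Lx k.1 * mode Lx Ly (cosW Lx Ly k c) f z) := by
  rw [mode_Dx_of_weight hx hy continuous_sinW (continuous_cosW.const_mul (wave Lx k.1))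
    (fun x y => (hasDerivAt_phase_x x y).sin.congr_deriv (by simp only [cosW]; ring))
    (fun y => by rw [sinW, phase_period_x hx, Real.sin_add_int_mul_two_pi, sinW]) hf hfp hz,
    mode_weight_const_mul]

theorem mode_cosW_Dy (hy : 0 < Ly) (hf : ContDiffOn ℝ 1 f slab)
    (hfp : HorizontallyPeriodic Lx Ly f) (hz : z ∈ Icc (0 : ℝ) 1) :
    mode Lx Ly (cosW Lx Ly k c) (Dy f) z = wave Ly k.2 * mode Lx Ly (sinW Lx Ly k c) f z := by
  rw [mode_Dy_of_weight hy continuous_cosW (continuous_sinW.const_mul (-wave Ly k.2))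
    (fun x y => (hasDerivAt_phase_y x y).cos.congr_deriv (by simp only [sinW]; ring))
    (fun y => by rw [cosW, phase_period_y hy, Real.cos_add_int_mul_two_pi, cosW]) hf hfp hz,
    mode_weight_const_mul]
  ring

theorem mode_sinW_Dy (hy : 0 < Ly) (hf : ContDiffOn ℝ 1 f slab)
    (hfp : HorizontallyPeriodic Lx Ly f) (hz : z ∈ Icc (0 : ℝ) 1) :
    mode Lx Ly (sinW Lx Ly k c) (Dy f) z = -(wave Ly k.2 * mode Lx Ly (cosW Lx Ly k c) f z) := by
  rw [mode_Dy_of_weight hy continuous_sinW (continuous_cosW.const_mul (wave Ly k.2))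
    (fun x y => (hasDerivAt_phase_y x y).sin.congr_deriv (by simp only [cosW]; ring))
    (fun y => by rw [sinW, phase_period_y hy, Real.sin_add_int_mul_two_pi, sinW]) hf hfp hz,
    mode_weight_const_mul]

end Mode

/-! ### The Stokes problem -/

/-- A horizontally periodic Stokes flow `(u, v, w)` in the layer, without slip at the plates and
driven by the vertical force `R f`. -/
structure StokesFlow (Lx Ly R : ℝ) (u v w p f : Pt → ℝ) : Prop where
  u_smooth : ContDiffOn ℝ 2 u slab
  v_smooth : ContDiffOn ℝ 2 v slab
  w_smooth : ContDiffOn ℝ 2 w slab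
  p_smooth : ContDiffOn ℝ 1 p slab
  f_cont : ContinuousOn f slab
  u_per : HorizontallyPeriodic Lx Ly u
  v_per : HorizontallyPeriodic Lx Ly v
  w_per : HorizontallyPeriodic Lx Ly w
  p_per : HorizontallyPeriodic Lx Ly p
  div_free : ∀ q ∈ openSlab, Dx u q + Dy v q + Dz w q = 0
  mom_x : ∀ q ∈ openSlab, Dx p q = Dx (Dx u) q + Dy (Dy u) q + Dz (Dz u) q
  mom_y : ∀ q ∈ openSlab, Dy p q = Dx (Dx v) q + Dy (Dy v) q + Dz (Dz v) q
  mom_z : ∀ q ∈ openSlab, Dz p q = Dx (Dx w) q + Dy (Dy w) q + Dz (Dz w) q + R * f q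
  bot : ∀ x y : ℝ, u (x, y, 0) = 0 ∧ v (x, y, 0) = 0 ∧ w (x, y, 0) = 0
  top : ∀ x y : ℝ, u (x, y, 1) = 0 ∧ v (x, y, 1) = 0 ∧ w (x, y, 1) = 0

/-- The squared amplitude of the `k`-th horizontal Fourier mode at height `z`. -/
def amp (Lx Ly : ℝ) (k : ℤ × ℤ) (f : Pt → ℝ) (z : ℝ) : ℝ :=
  mode Lx Ly (cosW Lx Ly k 0) f z ^ 2 + mode Lx Ly (sinW Lx Ly k 0) f z ^ 2

/-- The square of the length of a horizontal wave vector. -/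
def waveSq (Lx Ly : ℝ) (k : ℤ × ℤ) : ℝ := wave Lx k.1 ^ 2 + wave Ly k.2 ^ 2

theorem waveSq_nonneg (Lx Ly : ℝ) (k : ℤ × ℤ) : 0 ≤ waveSq Lx Ly k := by
  unfold waveSq; positivity

/-- The horizontal Fourier coefficients of a Laplacian. -/
theorem mode_lap {Lx Ly : ℝ} (hx : 0 < Lx) (hy : 0 < Ly) {k : ℤ × ℤ} {u : Pt → ℝ}
    (hu : ContDiffOn ℝ 2 u slab) (hp : HorizontallyPeriodic Lx Ly u) {c z : ℝ}
    (hz : z ∈ Icc (0 : ℝ) 1) :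
    mode Lx Ly (sinW Lx Ly k c) (fun q => Dx (Dx u) q + Dy (Dy u) q + Dz (Dz u) q) z
      = -(waveSq Lx Ly k * mode Lx Ly (sinW Lx Ly k c) u z)
        + mode Lx Ly (sinW Lx Ly k c) (Dz (Dz u)) z ∧
    mode Lx Ly (cosW Lx Ly k c) (fun q => Dx (Dx u) q + Dy (Dy u) q + Dz (Dz u) q) z
      = -(waveSq Lx Ly k * mode Lx Ly (cosW Lx Ly k c) u z)
        + mode Lx Ly (cosW Lx Ly k c) (Dz (Dz u)) z := by
  have u1 : ContDiffOn ℝ 1 u slab := hu.of_le (by norm_num)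
  have cx := continuousOn_Dx (contDiffOn_Dx hu)
  have cy := continuousOn_Dy (contDiffOn_Dy hu)
  have cz := continuousOn_Dz (contDiffOn_Dz hu)
  constructor
  · rw [mode_add continuous_sinW (f := fun q => Dx (Dx u) q + Dy (Dy u) q) (cx.add cy) cz hz,
      mode_add continuous_sinW cx cy hz, mode_sinW_Dx hx hy (contDiffOn_Dx hu) (hp.Dx u1) hz,
      mode_sinW_Dy hy (contDiffOn_Dy hu) (hp.Dy u1) hz, mode_cosW_Dx hx hy u1 hp hz,
      mode_cosW_Dy hy u1 hp hz, waveSq]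
    ring
  · rw [mode_add continuous_cosW (f := fun q => Dx (Dx u) q + Dy (Dy u) q) (cx.add cy) cz hz,
      mode_add continuous_cosW cx cy hz, mode_cosW_Dx hx hy (contDiffOn_Dx hu) (hp.Dx u1) hz,
      mode_cosW_Dy hy (contDiffOn_Dy hu) (hp.Dy u1) hz, mode_sinW_Dx hx hy u1 hp hz,
      mode_sinW_Dy hy u1 hp hz, waveSq]
    ring

namespace StokesFlow

variable {Lx Ly R : ℝ} {u v w p f : Pt → ℝ}

/-- The velocity is only C² and the pressure C¹, so w cannot be differentiated four times directly.
Each derivative is instead replaced by an expression from the equations: incompressibility gives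
`w₁` through the horizontal velocities, and the horizontal momentum equations give w₃ = κ(p̂ + w₁).
The vertical momentum equation then yields the derivative of `w₃`. -/
theorem clampedMode (h : StokesFlow Lx Ly R u v w p f) (hx : 0 < Lx) (hy : 0 < Ly)
    (k : ℤ × ℤ) (c : ℝ) : ∃ w₁ w₂ w₃ : ℝ → ℝ,
      ClampedMode (waveSq Lx Ly k) R (mode Lx Ly (cosW Lx Ly k c) w) w₁ w₂ w₃
        (mode Lx Ly (cosW Lx Ly k c) f) := by
  have u1 : ContDiffOn ℝ 1 u slab := h.u_smooth.of_le (by norm_num)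
  have v1 : ContDiffOn ℝ 1 v slab := h.v_smooth.of_le (by norm_num)
  have w1 : ContDiffOn ℝ 1 w slab := h.w_smooth.of_le (by norm_num)
  have C : Continuous (cosW Lx Ly k c) := continuous_cosW
  have S : Continuous (sinW Lx Ly k c) := continuous_sinW
  set κ := waveSq Lx Ly k with hκ
  set a := wave Lx k.1 with ha
  set b := wave Ly k.2 with hb
  have hκab : κ = a ^ 2 + b ^ 2 := rfl
  set w₁ : ℝ → ℝ := fun z =>
    -(a * mode Lx Ly (sinW Lx Ly k c) u z + b * mode Lx Ly (sinW Lx Ly k c) v z) with hw₁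
  set w₂ : ℝ → ℝ := fun z =>
    -(a * mode Lx Ly (sinW Lx Ly k c) (Dz u) z + b * mode Lx Ly (sinW Lx Ly k c) (Dz v) z) with hw₂
  have cu := continuousOn_mode (Lx := Lx) (Ly := Ly) S h.u_smooth.continuousOn
  have cv := continuousOn_mode (Lx := Lx) (Ly := Ly) S h.v_smooth.continuousOn
  have cw := continuousOn_mode (Lx := Lx) (Ly := Ly) C h.w_smooth.continuousOn
  have cp := continuousOn_mode (Lx := Lx) (Ly := Ly) C h.p_smooth.continuousOn
  have cuz := continuousOn_mode (Lx := Lx) (Ly := Ly) S (continuousOn_Dz u1)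
  have cvz := continuousOn_mode (Lx := Lx) (Ly := Ly) S (continuousOn_Dz v1)
  have e1 : ∀ z ∈ Ioo (0 : ℝ) 1, mode Lx Ly (cosW Lx Ly k c) (Dz w) z = w₁ z := by
    intro z hz
    have hz' := Ioo_subset_Icc_self hz
    have e : mode Lx Ly (cosW Lx Ly k c) (fun q => Dx u q + Dy v q + Dz w q) z = 0 :=
      mode_eq_zero fun x y => h.div_free (x, y, z) hz
    rw [mode_add C (f := fun q => Dx u q + Dy v q) ((continuousOn_Dx u1).add (continuousOn_Dy v1))
      (continuousOn_Dz w1) hz', mode_add C (continuousOn_Dx u1) (continuousOn_Dy v1) hz',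
      mode_cosW_Dx hx hy u1 h.u_per hz', mode_cosW_Dy hy v1 h.v_per hz'] at e
    simp only [hw₁]
    linarith
  have d1 : ∀ z ∈ Ioo (0 : ℝ) 1, HasDerivAt w₁ (w₂ z) z := fun z hz =>
    (((hasDerivAt_mode S u1 hz).const_mul a).add ((hasDerivAt_mode S v1 hz).const_mul b)).neg
  -- The mode of ∂z w and `w₁` agree on the open interval, so their derivatives do; this substitutes
  -- for ŵ'' in the vertical momentum equation.
  have e2 : ∀ z ∈ Ioo (0 : ℝ) 1, mode Lx Ly (cosW Lx Ly k c) (Dz (Dz w)) z = w₂ z := by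
    intro z hz
    refine (hasDerivAt_mode C (contDiffOn_Dz h.w_smooth) hz).unique
      ((d1 z hz).congr_of_eventuallyEq ?_)
    filter_upwards [isOpen_Ioo.mem_nhds hz] with s hs using e1 s hs
  refine ⟨w₁, w₂, fun z => κ * (mode Lx Ly (cosW Lx Ly k c) p z + w₁ z), ⟨cw, by fun_prop,
    by fun_prop, by fun_prop, continuousOn_mode C h.f_cont, fun z hz => ?_, d1, fun z hz => ?_,
    fun z hz => ?_, mode_eq_zero fun x y => (h.bot x y).2.2, ?_,
    mode_eq_zero fun x y => (h.top x y).2.2, ?_⟩⟩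
  · rw [← e1 z hz]
    exact hasDerivAt_mode C w1 hz
  · refine ((((hasDerivAt_mode S (contDiffOn_Dz h.u_smooth) hz).const_mul a).add
      ((hasDerivAt_mode S (contDiffOn_Dz h.v_smooth) hz).const_mul b)).neg).congr_deriv ?_
    have hz' := Ioo_subset_Icc_self hz
    have mx := mode_congr (Lx := Lx) (Ly := Ly) (ρ := sinW Lx Ly k c) (z := z) (f := Dx p)
      (g := fun q => Dx (Dx u) q + Dy (Dy u) q + Dz (Dz u) q) fun x y => h.mom_x (x, y, z) hz
    have my := mode_congr (Lx := Lx) (Ly := Ly) (ρ := sinW Lx Ly k c) (z := z) (f := Dy p)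
      (g := fun q => Dx (Dx v) q + Dy (Dy v) q + Dz (Dz v) q) fun x y => h.mom_y (x, y, z) hz
    rw [(mode_lap hx hy h.u_smooth h.u_per hz').1, mode_sinW_Dx hx hy h.p_smooth h.p_per hz'] at mx
    rw [(mode_lap hx hy h.v_smooth h.v_per hz').1, mode_sinW_Dy hy h.p_smooth h.p_per hz'] at my
    simp only [hw₁, ← ha, ← hb, ← hκ] at mx my ⊢
    rw [hκab] at mx my ⊢
    linear_combination a * mx + b * my
  · refine (((hasDerivAt_mode C h.p_smooth hz).add (d1 z hz)).const_mul κ).congr_deriv ?_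
    have hz' := Ioo_subset_Icc_self hz
    have mz := mode_congr (Lx := Lx) (Ly := Ly) (ρ := cosW Lx Ly k c) (z := z) (f := Dz p)
      (g := fun q => (Dx (Dx w) q + Dy (Dy w) q + Dz (Dz w) q) + R * f q)
      fun x y => h.mom_z (x, y, z) hz
    rw [mode_add C (f := fun q => Dx (Dx w) q + Dy (Dy w) q + Dz (Dz w) q) (g := fun q => R * f q)
      (((continuousOn_Dx (contDiffOn_Dx h.w_smooth)).add
      (continuousOn_Dy (contDiffOn_Dy h.w_smooth))).add
      (continuousOn_Dz (contDiffOn_Dz h.w_smooth))) (h.f_cont.const_mul R) hz',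
      mode_const_mul] at mz
    have ml := (mode_lap (c := c) (k := k) hx hy h.w_smooth h.w_per hz').2
    have mz' := mz.trans (congrArg₂ (· + ·) ml rfl)
    rw [mz', e2 z hz, ← hκ]
    ring
  -- The second clamped condition is no-slip for the horizontal velocity, read through
  -- incompressibility.
  · simp only [hw₁]
    rw [mode_eq_zero fun x y => (h.bot x y).1, mode_eq_zero fun x y => (h.bot x y).2.1]
    simp
  · simp only [hw₁]
    rw [mode_eq_zero fun x y => (h.top x y).1, mode_eq_zero fun x y => (h.top x y).2.1]
    simp

end StokesFlow

/-! ### Summation over the Fourier modes -/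

theorem continuousOn_amp {Lx Ly : ℝ} {k : ℤ × ℤ} {g : Pt → ℝ} (hg : ContinuousOn g slab) :
    ContinuousOn (amp Lx Ly k g) (Icc 0 1) :=
  ((continuousOn_mode continuous_cosW hg).pow 2).add
    ((continuousOn_mode continuous_sinW hg).pow 2)

/-- Parseval's identity on a horizontal slice. -/
theorem hasSum_amp {Lx Ly : ℝ} (hx : 0 < Lx) (hy : 0 < Ly) {g : Pt → ℝ}
    (hg : ContinuousOn g slab) {z : ℝ} (hz : z ∈ Icc (0 : ℝ) 1) :
    HasSum (fun k : ℤ × ℤ => (Lx * Ly)⁻¹ * amp Lx Ly k g z)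
      (slice Lx Ly (fun q => g q ^ 2) z) := by
  have := hasSum_sq_rect hx hy (ContinuousOn.slice_slab hg hz).continuousOn
  simpa only [amp, mode, slice, cosW, sinW, add_zero] using this

/-- A Bessel inequality on finite sets of modes suffices, since estimates on w are obtained by
bounding partial sums; no exchange of infinite sum and vertical integral is needed. -/
theorem integral_sum_amp_le {Lx Ly : ℝ} (hx : 0 < Lx) (hy : 0 < Ly) {g : Pt → ℝ}
    (hg : ContinuousOn g slab) (s : Finset (ℤ × ℤ)) :
    ∑ k ∈ s, (Lx * Ly)⁻¹ * ∫ z in (0 : ℝ)..1, amp Lx Ly k g z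
      ≤ ∫ q in cell Lx Ly, g q ^ 2 := by
  have hi : ∀ k, IntervalIntegrable (fun z => (Lx * Ly)⁻¹ * amp Lx Ly k g z) volume 0 1 := fun k =>
    ((continuousOn_amp hg).const_mul _).intervalIntegrable_of_Icc zero_le_one
  rw [setIntegral_cell_slice (g := fun q => g q ^ 2) (hg.pow 2)]
  simp only [← intervalIntegral.integral_const_mul]
  rw [← intervalIntegral.integral_finsetSum fun k _ => hi k]
  refine intervalIntegral.integral_mono_on zero_le_one
    (ContinuousOn.intervalIntegrable_of_Icc zero_le_one
      (continuousOn_finsetSum s fun k _ => (continuousOn_amp hg).const_mul _))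
    ((continuousOn_slice (hg.pow 2)).intervalIntegrable_of_Icc zero_le_one) fun z hz => ?_
  exact sum_le_hasSum s (fun k _ => by unfold amp; positivity) (hasSum_amp hx hy hg hz)

/-- Converts the factor κ of the mode estimates into horizontal derivatives of the forcing. -/
theorem amp_gradient {Lx Ly : ℝ} (hx : 0 < Lx) (hy : 0 < Ly) {k : ℤ × ℤ} {f : Pt → ℝ}
    (hf : ContDiffOn ℝ 1 f slab) (hp : HorizontallyPeriodic Lx Ly f) {z : ℝ}
    (hz : z ∈ Icc (0 : ℝ) 1) :
    amp Lx Ly k (Dx f) z + amp Lx Ly k (Dy f) z = waveSq Lx Ly k * amp Lx Ly k f z := by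
  simp only [amp, mode_cosW_Dx hx hy hf hp hz, mode_sinW_Dx hx hy hf hp hz,
    mode_cosW_Dy hy hf hp hz, mode_sinW_Dy hy hf hp hz, waveSq]
  ring

theorem integral_amp_eq {Lx Ly : ℝ} {k : ℤ × ℤ} {f : Pt → ℝ} (hf : ContinuousOn f slab) :
    ∫ z in (0 : ℝ)..1, amp Lx Ly k f z
      = (∫ z in (0 : ℝ)..1, mode Lx Ly (cosW Lx Ly k 0) f z ^ 2)
        + ∫ z in (0 : ℝ)..1, mode Lx Ly (sinW Lx Ly k 0) f z ^ 2 :=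
  intervalIntegral.integral_add
    (((continuousOn_mode continuous_cosW hf).pow 2).intervalIntegrable_of_Icc zero_le_one)
    (((continuousOn_mode continuous_sinW hf).pow 2).intervalIntegrable_of_Icc zero_le_one)

namespace StokesFlow

variable {Lx Ly R : ℝ} {u v w p f : Pt → ℝ}

theorem amp_le (h : StokesFlow Lx Ly R u v w p f) (hx : 0 < Lx) (hy : 0 < Ly)
    (k : ℤ × ℤ) {z : ℝ} (hz : z ∈ Icc (0 : ℝ) 1) :
    amp Lx Ly k w z ≤ R ^ 2 * ∫ z in (0 : ℝ)..1, amp Lx Ly k f z := by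
  obtain ⟨a₁, a₂, a₃, ha⟩ := h.clampedMode hx hy k 0
  obtain ⟨b₁, b₂, b₃, hb⟩ := h.clampedMode hx hy k (-(Real.pi / 2))
  rw [← sinW_eq_cosW] at hb
  rw [integral_amp_eq h.f_cont, mul_add]
  exact add_le_add (ha.sq_le (waveSq_nonneg _ _ _) hz) (hb.sq_le (waveSq_nonneg _ _ _) hz)

theorem amp_le_pow_four (h : StokesFlow Lx Ly R u v w p f) (hx : 0 < Lx) (hy : 0 < Ly)
    (k : ℤ × ℤ) {z : ℝ} (hz : z ∈ Icc (0 : ℝ) 1) :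
    amp Lx Ly k w z ≤ 66 * R ^ 2 * z ^ 4 *
      ((1 + waveSq Lx Ly k) * ∫ z in (0 : ℝ)..1, amp Lx Ly k f z) := by
  obtain ⟨a₁, a₂, a₃, ha⟩ := h.clampedMode hx hy k 0
  obtain ⟨b₁, b₂, b₃, hb⟩ := h.clampedMode hx hy k (-(Real.pi / 2))
  rw [← sinW_eq_cosW] at hb
  rw [integral_amp_eq h.f_cont, mul_add, mul_add]
  exact add_le_add (ha.sq_le_pow_four (waveSq_nonneg _ _ _) hz)
    (hb.sq_le_pow_four (waveSq_nonneg _ _ _) hz)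

/-- The vertical velocity on each slice is controlled by the forcing in `L²`. -/
theorem slice_sq_le (h : StokesFlow Lx Ly R u v w p f) (hx : 0 < Lx) (hy : 0 < Ly)
    {z : ℝ} (hz : z ∈ Icc (0 : ℝ) 1) :
    slice Lx Ly (fun q => w q ^ 2) z ≤ R ^ 2 * ∫ q in cell Lx Ly, f q ^ 2 := by
  refine hasSum_le_of_sum_le (hasSum_amp hx hy h.w_smooth.continuousOn hz) fun s => ?_
  refine le_trans (Finset.sum_le_sum fun k _ => mul_le_mul_of_nonneg_left (h.amp_le hx hy k hz)
    (by positivity)) ?_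
  have := mul_le_mul_of_nonneg_left (integral_sum_amp_le hx hy h.f_cont s) (sq_nonneg R)
  refine le_trans (le_of_eq ?_) this
  rw [Finset.mul_sum]
  exact Finset.sum_congr rfl fun k _ => by ring

/-- The vertical velocity vanishes quadratically at the lower plate, in horizontal mean square,
with a constant depending only on the `L²` norm of the forcing and of its horizontal gradient. -/
theorem slice_sq_le_pow_four (h : StokesFlow Lx Ly R u v w p f) (hx : 0 < Lx) (hy : 0 < Ly)
    (hf : ContDiffOn ℝ 1 f slab) (hp : HorizontallyPeriodic Lx Ly f)
    {z : ℝ} (hz : z ∈ Icc (0 : ℝ) 1) :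
    slice Lx Ly (fun q => w q ^ 2) z ≤ 66 * R ^ 2 * z ^ 4 *
      ((∫ q in cell Lx Ly, f q ^ 2) + (∫ q in cell Lx Ly, Dx f q ^ 2)
        + ∫ q in cell Lx Ly, Dy f q ^ 2) := by
  refine hasSum_le_of_sum_le (hasSum_amp hx hy h.w_smooth.continuousOn hz) fun s => ?_
  refine le_trans (Finset.sum_le_sum fun k _ => mul_le_mul_of_nonneg_left
    (h.amp_le_pow_four hx hy k hz) (by positivity)) ?_
  have key : ∀ k, (1 + waveSq Lx Ly k) * ∫ z in (0 : ℝ)..1, amp Lx Ly k f z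
      = (∫ z in (0 : ℝ)..1, amp Lx Ly k f z) + (∫ z in (0 : ℝ)..1, amp Lx Ly k (Dx f) z)
        + ∫ z in (0 : ℝ)..1, amp Lx Ly k (Dy f) z := by
    intro k
    rw [add_assoc, ← intervalIntegral.integral_add
      ((continuousOn_amp (continuousOn_Dx hf)).intervalIntegrable_of_Icc zero_le_one)
      ((continuousOn_amp (continuousOn_Dy hf)).intervalIntegrable_of_Icc zero_le_one),
      add_mul, one_mul, ← intervalIntegral.integral_const_mul]
    congr 1
    refine intervalIntegral.integral_congr fun z hz => ?_
    rw [uIcc_of_le zero_le_one] at hz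
    exact (amp_gradient hx hy hf hp hz).symm
  have b := add_le_add (add_le_add (integral_sum_amp_le hx hy h.f_cont s)
    (integral_sum_amp_le hx hy (continuousOn_Dx hf) s))
    (integral_sum_amp_le hx hy (continuousOn_Dy hf) s)
  refine le_trans (le_of_eq ?_) (mul_le_mul_of_nonneg_left b (by positivity))
  rw [← Finset.sum_add_distrib, ← Finset.sum_add_distrib, Finset.mul_sum]
  exact Finset.sum_congr rfl fun k _ => by rw [key]; ring

end StokesFlow

/-! ### The background profile -/

/-- Integration by parts; this is the recursion for the Beta integrals, which gives the moments of
-τ'. -/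
theorem integral_pow_mul_pow_succ (m j : ℕ) :
    (m + 1 : ℝ) * ∫ z in (0 : ℝ)..1, (1 - z) ^ m * z ^ (j + 1)
      = (j + 1) * ∫ z in (0 : ℝ)..1, (1 - z) ^ (m + 1) * z ^ j := by
  have i : ∀ a b : ℕ, IntervalIntegrable (fun z : ℝ => (1 - z) ^ a * z ^ b) volume 0 1 :=
    fun a b => Continuous.intervalIntegrable (by fun_prop) _ _
  have := intervalIntegral.integral_eq_sub_of_hasDerivAt (a := (0 : ℝ)) (b := 1)
    (f := fun z : ℝ => (1 - z) ^ (m + 1) * z ^ (j + 1))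
    (f' := fun z => (j + 1) * ((1 - z) ^ (m + 1) * z ^ j) - (m + 1) * ((1 - z) ^ m * z ^ (j + 1)))
    (fun z _ => by
      refine ((((hasDerivAt_id z).const_sub 1).pow (m + 1)).mul
        ((hasDerivAt_id z).pow (j + 1))).congr_deriv ?_
      simp; ring) (Continuous.intervalIntegrable (by fun_prop) _ _)
  rw [intervalIntegral.integral_sub ((i _ _).const_mul _) ((i _ _).const_mul _),
    intervalIntegral.integral_const_mul, intervalIntegral.integral_const_mul] at this
  simp at this
  linarith

theorem integral_one_sub_pow (m : ℕ) : ∫ z in (0 : ℝ)..1, (1 - z) ^ m = 1 / (m + 1) := by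
  rw [intervalIntegral.integral_comp_sub_left (fun z => z ^ m), integral_pow]
  simp

theorem integral_profile_mul_le (m : ℕ) :
    ∫ z in (0 : ℝ)..1, (m + 1 : ℝ) * (1 - z) ^ m * z ≤ 1 / (m + 1 : ℝ) := by
  have h := integral_pow_mul_pow_succ m 0
  simp only [zero_add, pow_one, pow_zero, mul_one, Nat.cast_zero, one_mul,
    integral_one_sub_pow] at h
  simp only [mul_assoc, intervalIntegral.integral_const_mul]
  rw [h]
  push_cast
  gcongr
  linarith

theorem integral_profile_mul_pow_four_le (m : ℕ) :
    ∫ z in (0 : ℝ)..1, (m + 1 : ℝ) * (1 - z) ^ m * z ^ 4 ≤ 24 / (m + 1 : ℝ) ^ 4 := by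
  have h4 := integral_pow_mul_pow_succ m 3
  have h3 := integral_pow_mul_pow_succ (m + 1) 2
  have h2 := integral_pow_mul_pow_succ (m + 2) 1
  have h1 := integral_pow_mul_pow_succ (m + 3) 0
  simp only [pow_zero, mul_one, integral_one_sub_pow] at h1
  simp only [mul_assoc, intervalIntegral.integral_const_mul]
  push_cast at h1 h2 h3 h4
  norm_num [add_assoc] at h1 h2 h3 h4
  rw [h4]
  have hm : (0 : ℝ) ≤ m := Nat.cast_nonneg m
  rw [(eq_div_iff (by positivity)).2 ((mul_comm _ _).trans h3),
    (eq_div_iff (by positivity)).2 ((mul_comm _ _).trans h2),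
    (eq_div_iff (by positivity)).2 ((mul_comm _ _).trans h1),
    show (4 : ℝ) * (3 * (2 * ((m + 5 : ℝ)⁻¹ / (m + 4)) / (m + 3)) / (m + 2))
    = 24 / ((m + 2) * (m + 3) * (m + 4) * (m + 5)) by field_simp; norm_num]
  gcongr
  calc ((m : ℝ) + 1) ^ 4 = (m + 1) * (m + 1) * (m + 1) * (m + 1) := by ring
    _ ≤ _ := by gcongr <;> norm_num

/-- The background temperature profile `(1 - z)^(m+1)`. -/
def profile (m : ℕ) (z : ℝ) : ℝ := (1 - z) ^ (m + 1)

/-- The derivative of the background profile. -/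
def profile' (m : ℕ) (z : ℝ) : ℝ := -((m + 1 : ℝ) * (1 - z) ^ m)

theorem hasDerivAt_profile (m : ℕ) (z : ℝ) : HasDerivAt (profile m) (profile' m z) z := by
  refine (((hasDerivAt_id z).const_sub 1).pow (m + 1)).congr_deriv ?_
  simp [profile']

theorem contDiff_profile {k : WithTop ℕ∞} (m : ℕ) : ContDiff ℝ k (profile m) := by
  unfold profile; fun_prop

theorem continuous_profile (m : ℕ) : Continuous (profile m) := by unfold profile; fun_prop

theorem continuous_profile' (m : ℕ) : Continuous (profile' m) := by unfold profile'; fun_prop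

/-! ### One instant of the evolution -/

/-- The fields of a solution at one instant; `Tt` is the time derivative of the temperature. -/
structure Snapshot (Lx Ly R : ℝ) (T Tt u v w p : Pt → ℝ) : Prop where
  flow : StokesFlow Lx Ly R u v w p T
  T_smooth : ContDiffOn ℝ 2 T slab
  T_per : HorizontallyPeriodic Lx Ly T
  Tt_cont : ContinuousOn Tt slab
  heat : ∀ q ∈ openSlab, Tt q + (u q * Dx T q + v q * Dy T q + w q * Dz T q)
    = Dx (Dx T) q + Dy (Dy T) q + Dz (Dz T) q
  T_bot : ∀ x y : ℝ, T (x, y, 0) = 1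
  T_top : ∀ x y : ℝ, T (x, y, 1) = 0

/-- The deviation of the temperature from the background profile. -/
def deviation (m : ℕ) (T : Pt → ℝ) (q : Pt) : ℝ := T q - profile m q.2.2

/-- The multiplier `2τ - (1 - z) - T`, which vanishes at both plates. -/
def multiplier (m : ℕ) (T : Pt → ℝ) (q : Pt) : ℝ := 2 * profile m q.2.2 - (1 - q.2.2) - T q

theorem contDiffOn_deviation {k : WithTop ℕ∞} {m : ℕ} {T : Pt → ℝ} (hT : ContDiffOn ℝ k T slab) :
    ContDiffOn ℝ k (deviation m T) slab :=
  hT.sub (((contDiff_profile m).comp (by fun_prop)).contDiffOn)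

theorem HorizontallyPeriodic.deviation {Lx Ly : ℝ} {m : ℕ} {T : Pt → ℝ}
    (hT : HorizontallyPeriodic Lx Ly T) : HorizontallyPeriodic Lx Ly (deviation m T) := by
  intro x y z h0 h1
  simp only [RayleighBenard.deviation]
  rw [(hT x y z h0 h1).1, (hT x y z h0 h1).2]
  exact ⟨rfl, rfl⟩

theorem Dx_deviation {m : ℕ} {T : Pt → ℝ} (hT : ContDiffOn ℝ 1 T slab) {x y z : ℝ}
    (hz : z ∈ Icc (0 : ℝ) 1) : Dx (deviation m T) (x, y, z) = Dx T (x, y, z) :=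
  (hasDerivAt_Dx (contDiffOn_deviation hT) hz).unique
    ((hasDerivAt_Dx hT hz).sub_const (profile m z))

theorem Dy_deviation {m : ℕ} {T : Pt → ℝ} (hT : ContDiffOn ℝ 1 T slab) {x y z : ℝ}
    (hz : z ∈ Icc (0 : ℝ) 1) : Dy (deviation m T) (x, y, z) = Dy T (x, y, z) :=
  (hasDerivAt_Dy (contDiffOn_deviation hT) hz).unique
    ((hasDerivAt_Dy hT hz).sub_const (profile m z))

theorem Dz_deviation {m : ℕ} {T : Pt → ℝ} (hT : ContDiffOn ℝ 1 T slab) {x y z : ℝ}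
    (hz : z ∈ Ioo (0 : ℝ) 1) :
    Dz (deviation m T) (x, y, z) = Dz T (x, y, z) - profile' m z :=
  (hasDerivAt_Dz (contDiffOn_deviation hT) hz).unique
    ((hasDerivAt_Dz hT hz).sub (hasDerivAt_profile m z))

/-- Subtracting the background profile from the forcing only changes the pressure. -/
theorem StokesFlow.deviation {Lx Ly R : ℝ} {u v w p T : Pt → ℝ}
    (h : StokesFlow Lx Ly R u v w p T) (m : ℕ) :
    StokesFlow Lx Ly R u v w (fun q => p q + R / (m + 2) * profile (m + 1) q.2.2)
      (deviation m T) := by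
  have hp : ContDiffOn ℝ 1 (fun q : Pt => p q + R / (m + 2) * profile (m + 1) q.2.2) slab :=
    h.p_smooth.add (contDiffOn_const.mul
      ((contDiff_profile (m + 1)).comp (by fun_prop)).contDiffOn)
  refine { h with
    p_smooth := hp
    f_cont := h.f_cont.sub ((continuous_profile m).comp (by fun_prop)).continuousOn
    p_per := ?_, mom_x := ?_, mom_y := ?_, mom_z := ?_ }
  · intro x y z h0 h1
    simp only
    rw [(h.p_per x y z h0 h1).1, (h.p_per x y z h0 h1).2]
    exact ⟨rfl, rfl⟩
  · rintro ⟨x, y, z⟩ hq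
    rw [← h.mom_x _ hq]
    exact (hasDerivAt_Dx hp (openSlab_subset_slab hq)).unique
      ((hasDerivAt_Dx h.p_smooth (openSlab_subset_slab hq)).add_const
        (R / (m + 2) * profile (m + 1) z))
  · rintro ⟨x, y, z⟩ hq
    rw [← h.mom_y _ hq]
    exact (hasDerivAt_Dy hp (openSlab_subset_slab hq)).unique
      ((hasDerivAt_Dy h.p_smooth (openSlab_subset_slab hq)).add_const
        (R / (m + 2) * profile (m + 1) z))
  · rintro ⟨x, y, z⟩ hq
    have e := h.mom_z _ hq
    -- The added pressure is chosen so that its z-derivative is -R τ: the derivative of (1 -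
    -- z)^(m+2) is -(m+2)(1 - z)^(m+1).
    have e2 := (hasDerivAt_Dz (x := x) (y := y) hp hq).unique
      ((hasDerivAt_Dz h.p_smooth hq).add ((hasDerivAt_profile (m + 1) z).const_mul (R / (m + 2))))
    rw [e2, e, RayleighBenard.deviation, profile', profile]
    push_cast
    field_simp
    ring

theorem slice_mono {Lx Ly : ℝ} {f g : Pt → ℝ} (hf : ContinuousOn f slab)
    (hg : ContinuousOn g slab) {z : ℝ} (hz : z ∈ Icc (0 : ℝ) 1)
    (h : ∀ x y, f (x, y, z) ≤ g (x, y, z)) : slice Lx Ly f z ≤ slice Lx Ly g z :=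
  integral_mono (integrableOn_rect hf hz) (integrableOn_rect hg hz) fun r => h r.1 r.2

theorem slice_mul_left {Lx Ly : ℝ} (c : ℝ → ℝ) (f : Pt → ℝ) (z : ℝ) :
    slice Lx Ly (fun q => c q.2.2 * f q) z = c z * slice Lx Ly f z := by
  unfold slice; rw [← integral_const_mul]

/-- Vertical Poincaré inequality on slices. -/
theorem slice_sq_le_of_bot {Lx Ly : ℝ} {f : Pt → ℝ} (hf : ContDiffOn ℝ 1 f slab)
    (h0 : ∀ x y, f (x, y, 0) = 0) {z : ℝ} (hz : z ∈ Icc (0 : ℝ) 1) :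
    slice Lx Ly (fun q => f q ^ 2) z ≤ z * ∫ q in cell Lx Ly, Dz f q ^ 2 := by
  have cz := continuousOn_Dz hf
  have vert : ∀ {g : Pt → ℝ}, ContinuousOn g slab → ∀ x y : ℝ,
      ContinuousOn (fun s => g (x, y, s)) (Icc 0 1) := fun hg x y =>
    hg.comp (f := fun s : ℝ => (x, y, s)) (by fun_prop) fun _ hs => hs
  rw [setIntegral_cell_vertical (g := fun q => Dz f q ^ 2) (cz.pow 2), ← integral_const_mul]
  refine setIntegral_mono (integrableOn_rect (f := fun q => f q ^ 2) (hf.continuousOn.pow 2) hz)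
    ?_ fun r => ?_
  · refine Integrable.const_mul (IntegrableOn.integrable
      (ContinuousOn.integrableOn_compact (isCompact_rect Lx Ly) ?_)) z
    simp only [intervalIntegral.integral_of_le zero_le_one, ← integral_Icc_eq_integral_Ioc]
    exact continuousOn_setIntegral (f := fun (r : ℝ × ℝ) s => Dz f (r.1, r.2, s) ^ 2)
      isCompact_Icc ((ContinuousOn.prodAssoc_slab (cz.pow 2)).mono
        (prod_mono_left (subset_univ _)))
  · exact sq_le_of_hasDerivAt (vert hf.continuousOn r.1 r.2) (vert cz r.1 r.2)
      (fun s hs => hasDerivAt_Dz hf hs) (h0 r.1 r.2) hz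

theorem setIntegral_sq_le_of_bot {Lx Ly : ℝ} {f : Pt → ℝ} (hf : ContDiffOn ℝ 1 f slab)
    (h0 : ∀ x y, f (x, y, 0) = 0) :
    ∫ q in cell Lx Ly, f q ^ 2 ≤ ∫ q in cell Lx Ly, Dz f q ^ 2 := by
  have hD : 0 ≤ ∫ q in cell Lx Ly, Dz f q ^ 2 := integral_nonneg fun q => sq_nonneg _
  have c2 : ContinuousOn (fun q => f q ^ 2) slab := hf.continuousOn.pow 2
  rw [setIntegral_cell_slice c2]
  calc ∫ z in (0 : ℝ)..1, slice Lx Ly (fun q => f q ^ 2) z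
      ≤ ∫ _z in (0 : ℝ)..1, ∫ q in cell Lx Ly, Dz f q ^ 2 := by
        refine intervalIntegral.integral_mono_on zero_le_one
          ((continuousOn_slice c2).intervalIntegrable_of_Icc zero_le_one) (by simp) fun z hz => ?_
        exact (slice_sq_le_of_bot hf h0 hz).trans (mul_le_of_le_one_left hD hz.2)
    _ = _ := by simp

namespace Snapshot

variable {Lx Ly R : ℝ} {T Tt u v w p : Pt → ℝ}

/-- The dissipation of the deviation from the background. -/
def dissipation (Lx Ly : ℝ) (m : ℕ) (T : Pt → ℝ) : ℝ :=
  (∫ q in cell Lx Ly, Dx (deviation m T) q ^ 2) + (∫ q in cell Lx Ly, Dy (deviation m T) q ^ 2)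
    + ∫ q in cell Lx Ly, Dz (deviation m T) q ^ 2

/-- **Spectral constraint**: a thin enough background profile makes the quadratic form of the
background method nonnegative. -/
theorem spectral_constraint (h : Snapshot Lx Ly R T Tt u v w p) (hx : 0 < Lx) (hy : 0 < Ly)
    (hR : 0 < R) {m : ℕ} {s : ℝ} (hs : 0 < s) (hsm : s ^ 2 = m + 1) (hsR : 1585 * R ≤ s ^ 5) :
    -(∫ q in cell Lx Ly, 2 * profile' m q.2.2 * w q * deviation m T q)
      ≤ dissipation Lx Ly m T := by
  have T1 : ContDiffOn ℝ 1 T slab := h.T_smooth.of_le (by norm_num)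
  have θ1 : ContDiffOn ℝ 1 (deviation m T) slab := contDiffOn_deviation T1
  have θc := θ1.continuousOn
  have wc := h.flow.w_smooth.continuousOn
  have pc : ContinuousOn (fun q : Pt => profile' m q.2.2) slab :=
    ((continuous_profile' m).comp (by fun_prop)).continuousOn
  have θ0 : ∀ x y, deviation m T (x, y, 0) = 0 := fun x y => by
    simp [deviation, profile, h.T_bot]
  set D := dissipation Lx Ly m T with hD
  have nx : 0 ≤ ∫ q in cell Lx Ly, Dx (deviation m T) q ^ 2 := integral_nonneg fun q => sq_nonneg _
  have ny : 0 ≤ ∫ q in cell Lx Ly, Dy (deviation m T) q ^ 2 := integral_nonneg fun q => sq_nonneg _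
  have nz : 0 ≤ ∫ q in cell Lx Ly, Dz (deviation m T) q ^ 2 := integral_nonneg fun q => sq_nonneg _
  have D0 : 0 ≤ D := add_nonneg (add_nonneg nx ny) nz
  -- The Stokes flow is regarded as driven by θ; since θ vanishes at the bottom, ∫θ² ≤ ∫(∂z θ)²,
  -- which completes the horizontal gradient to the full dissipation.
  have bw : ∀ z ∈ Icc (0 : ℝ) 1, slice Lx Ly (fun q => w q ^ 2) z ≤ 66 * R ^ 2 * z ^ 4 * D := by
    intro z hz
    refine ((h.flow.deviation m).slice_sq_le_pow_four hx hy θ1 h.T_per.deviation hz).trans ?_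
    refine mul_le_mul_of_nonneg_left ?_ (by positivity)
    have := setIntegral_sq_le_of_bot (Lx := Lx) (Ly := Ly) θ1 θ0
    rw [hD, dissipation]
    linarith
  have bθ : ∀ z ∈ Icc (0 : ℝ) 1, slice Lx Ly (fun q => deviation m T q ^ 2) z ≤ z * D := by
    intro z hz
    refine (slice_sq_le_of_bot θ1 θ0 hz).trans (mul_le_mul_of_nonneg_left ?_ hz.1)
    rw [hD, dissipation]
    linarith
  -- The weight of the arithmetic-geometric inequality. With s² = m + 1 the two contributions become
  -- 66·24 R/s⁵ and R/s⁵, whence 1585.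
  set l := s ^ 3 / R with hl
  have hl0 : 0 < l := by positivity
  have cneg : ContinuousOn (fun q => -(2 * profile' m q.2.2 * w q * deviation m T q)) slab := by
    fun_prop
  have cE : ContinuousOn (fun q => l * w q ^ 2 + l⁻¹ * deviation m T q ^ 2) slab := by fun_prop
  have cW : ContinuousOn (fun q => -profile' m q.2.2 * (l * w q ^ 2 + l⁻¹ * deviation m T q ^ 2))
      slab := by fun_prop
  have npz : ∀ z ∈ Icc (0 : ℝ) 1, 0 ≤ -profile' m z := fun z hz => by
    have : 0 ≤ 1 - z := by linarith [hz.2]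
    simp only [profile', neg_neg]; positivity
  rw [← integral_neg, setIntegral_cell_slice cneg]
  calc ∫ z in (0 : ℝ)..1, slice Lx Ly (fun q => -(2 * profile' m q.2.2 * w q * deviation m T q)) z
      ≤ ∫ z in (0 : ℝ)..1, (l * (66 * R ^ 2 * D) * ((m + 1 : ℝ) * (1 - z) ^ m * z ^ 4)
          + l⁻¹ * D * ((m + 1 : ℝ) * (1 - z) ^ m * z)) := by
        refine intervalIntegral.integral_mono_on zero_le_one
          ((continuousOn_slice cneg).intervalIntegrable_of_Icc zero_le_one)
          (Continuous.intervalIntegrable (by fun_prop) _ _) fun z hz => ?_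
        have am : ∀ a b : ℝ, 2 * (a * b) ≤ l * a ^ 2 + l⁻¹ * b ^ 2 := fun a b => by
          have e : l * a ^ 2 + l⁻¹ * b ^ 2 - 2 * (a * b) = l⁻¹ * (l * a - b) ^ 2 := by
            field_simp; ring
          have : 0 ≤ l⁻¹ * (l * a - b) ^ 2 := by positivity
          linarith
        refine (slice_mono cneg cW hz fun x y => ?_).trans ?_
        · have := mul_le_mul_of_nonneg_left (am (w (x, y, z)) (deviation m T (x, y, z))) (npz z hz)
          simp only
          linarith
        · rw [slice_mul_left (fun z => -profile' m z)]
          have e : slice Lx Ly (fun q => l * w q ^ 2 + l⁻¹ * deviation m T q ^ 2) z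
              = l * slice Lx Ly (fun q => w q ^ 2) z
                + l⁻¹ * slice Lx Ly (fun q => deviation m T q ^ 2) z := by
            unfold slice
            rw [← integral_const_mul, ← integral_const_mul]
            exact integral_add
              (integrableOn_rect (f := fun q => l * w q ^ 2) (by fun_prop) hz)
              (integrableOn_rect (f := fun q => l⁻¹ * deviation m T q ^ 2) (by fun_prop) hz)
          rw [e]
          have k1 := mul_le_mul_of_nonneg_left (bw z hz) hl0.le
          have k2 := mul_le_mul_of_nonneg_left (bθ z hz) (inv_pos.2 hl0).le
          refine (mul_le_mul_of_nonneg_left (add_le_add k1 k2) (npz z hz)).trans_eq ?_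
          simp only [profile']; ring
    _ ≤ l * (66 * R ^ 2 * D) * (24 / (m + 1) ^ 4) + l⁻¹ * D * (1 / (m + 1)) := by
        rw [intervalIntegral.integral_add (Continuous.intervalIntegrable (by fun_prop) _ _)
          (Continuous.intervalIntegrable (by fun_prop) _ _),
          intervalIntegral.integral_const_mul, intervalIntegral.integral_const_mul]
        exact add_le_add
          (mul_le_mul_of_nonneg_left (integral_profile_mul_pow_four_le m) (by positivity))
          (mul_le_mul_of_nonneg_left (integral_profile_mul_le m) (by positivity))
    _ = (1585 * R / s ^ 5) * D := by
        rw [← hsm, hl]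
        field_simp
        ring
    _ ≤ D := by
        refine mul_le_of_le_one_left D0 ?_
        rw [div_le_one (by positivity)]
        exact hsR

end Snapshot

/-! ### Energy identity and flux bound at one instant -/

theorem volume_rect {Lx Ly : ℝ} (hx : 0 < Lx) (hy : 0 < Ly) :
    volume.real (rect Lx Ly) = Lx * Ly := by
  rw [rect, Measure.volume_eq_prod, measureReal_prod_prod]
  simp [hx.le, hy.le]

/-- The conductive part of the flux is fixed by the plate temperatures, so only the convective part
has to be estimated. -/
theorem setIntegral_Dz {Lx Ly : ℝ} (hx : 0 < Lx) (hy : 0 < Ly) {T : Pt → ℝ}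
    (hT : ContDiffOn ℝ 1 T slab) (h0 : ∀ x y : ℝ, T (x, y, 0) = 1)
    (h1 : ∀ x y : ℝ, T (x, y, 1) = 0) : ∫ q in cell Lx Ly, Dz T q = -(Lx * Ly) := by
  rw [setIntegral_cell_vertical (continuousOn_Dz hT)]
  have e : ∀ r : ℝ × ℝ, ∫ z in (0 : ℝ)..1, Dz T (r.1, r.2, z) = -1 := fun r => by
    have vert : ∀ {g : Pt → ℝ}, ContinuousOn g slab →
        ContinuousOn (fun s => g (r.1, r.2, s)) (Icc 0 1) := fun hg =>
      hg.comp (f := fun s : ℝ => (r.1, r.2, s)) (by fun_prop) fun _ hs => hs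
    rw [intervalIntegral.integral_eq_sub_of_hasDerivAt_of_le zero_le_one (vert hT.continuousOn)
      (fun z hz => hasDerivAt_Dz hT hz)
      ((vert (continuousOn_Dz hT)).intervalIntegrable_of_Icc zero_le_one), h0, h1]
    norm_num
  simp only [e]
  rw [setIntegral_const, volume_rect hx hy]
  simp

theorem setIntegral_profile'_sq_le {Lx Ly : ℝ} (hx : 0 < Lx) (hy : 0 < Ly) (m : ℕ) :
    ∫ q in cell Lx Ly, profile' m q.2.2 ^ 2 ≤ Lx * Ly * (m + 1) := by
  have pc : Continuous (fun q : Pt => profile' m q.2.2 ^ 2) :=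
    ((continuous_profile' m).comp (by fun_prop)).pow 2
  rw [setIntegral_cell_slice pc.continuousOn]
  have e : ∀ z, slice Lx Ly (fun q => profile' m q.2.2 ^ 2) z
      = Lx * Ly * (m + 1) ^ 2 * (1 - z) ^ (2 * m) := fun z => by
    simp only [slice]
    rw [setIntegral_const, volume_rect hx hy]
    simp only [profile', smul_eq_mul]
    ring
  simp only [e]
  rw [intervalIntegral.integral_const_mul, integral_one_sub_pow]
  have : ((m : ℝ) + 1) ^ 2 * (1 / ((2 * m : ℕ) + 1)) ≤ m + 1 := by
    rw [mul_one_div, div_le_iff₀ (by positivity)]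
    push_cast
    nlinarith [(Nat.cast_nonneg m : (0 : ℝ) ≤ m)]
  rw [mul_assoc]
  exact mul_le_mul_of_nonneg_left this (by positivity)

namespace Snapshot

variable {Lx Ly R : ℝ} {T Tt u v w p : Pt → ℝ}

/-- The energy identity of the background method. -/
theorem energy_identity (h : Snapshot Lx Ly R T Tt u v w p) (hx : 0 < Lx) (hy : 0 < Ly) (m : ℕ) :
    (∫ q in cell Lx Ly, w q * T q) + Lx * Ly
      = (∫ q in cell Lx Ly, multiplier m T q * Tt q) + (∫ q in cell Lx Ly, profile' m q.2.2 ^ 2)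
        - dissipation Lx Ly m T
        - ∫ q in cell Lx Ly, 2 * profile' m q.2.2 * w q * deviation m T q := by
  have T2 := h.T_smooth
  have T1 : ContDiffOn ℝ 1 T slab := T2.of_le (by norm_num)
  have u1 : ContDiffOn ℝ 1 u slab := h.flow.u_smooth.of_le (by norm_num)
  have v1 : ContDiffOn ℝ 1 v slab := h.flow.v_smooth.of_le (by norm_num)
  have w1 : ContDiffOn ℝ 1 w slab := h.flow.w_smooth.of_le (by norm_num)
  have θ1 : ContDiffOn ℝ 1 (deviation m T) slab := contDiffOn_deviation T1
  have cT := T1.continuousOn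
  have cTt := h.Tt_cont
  have cu := u1.continuousOn
  have cv := v1.continuousOn
  have cw := w1.continuousOn
  have cθ := θ1.continuousOn
  have cTx := continuousOn_Dx T1
  have cTy := continuousOn_Dy T1
  have cTz := continuousOn_Dz T1
  have cθx := continuousOn_Dx θ1
  have cθy := continuousOn_Dy θ1
  have cθz := continuousOn_Dz θ1
  have cux := continuousOn_Dx u1
  have cvy := continuousOn_Dy v1
  have cwz := continuousOn_Dz w1
  have cTxx := continuousOn_Dx (contDiffOn_Dx T2)
  have cTyy := continuousOn_Dy (contDiffOn_Dy T2)
  have cTzz := continuousOn_Dz (contDiffOn_Dz T2)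
  have cp : Continuous (profile m) := continuous_profile m
  have cp' : Continuous (profile' m) := continuous_profile' m
  have cχ : ContinuousOn (multiplier m T) slab := by unfold multiplier; fun_prop
  set φ : ℝ → ℝ := fun z => 2 * profile m z - (1 - z) with hφ
  have cφ : Continuous φ := by fun_prop
  have dφ : ∀ z, HasDerivAt φ (2 * profile' m z + 1) z := fun z => by
    refine (((hasDerivAt_profile m z).const_mul 2).sub
      ((hasDerivAt_id z).const_sub 1)).congr_deriv ?_
    ring
  -- Terms of the divergence of (φ - T)∇T - u(φT - T²/2) + u τ²: the heat equation tested with φ -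
  -- T, plus a correction that cancels ∫2ττ'w by incompressibility.
  set W₁' : Pt → ℝ := fun q => -Dx T q * Dx T q + (φ q.2.2 - T q) * Dx (Dx T) q
    - (Dx u q * (φ q.2.2 * T q - T q ^ 2 / 2) + u q * (φ q.2.2 * Dx T q - T q * Dx T q))
    + Dx u q * profile m q.2.2 ^ 2 with hW₁
  set W₂' : Pt → ℝ := fun q => -Dy T q * Dy T q + (φ q.2.2 - T q) * Dy (Dy T) q
    - (Dy v q * (φ q.2.2 * T q - T q ^ 2 / 2) + v q * (φ q.2.2 * Dy T q - T q * Dy T q))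
    + Dy v q * profile m q.2.2 ^ 2 with hW₂
  set W₃' : Pt → ℝ := fun q =>
    (2 * profile' m q.2.2 + 1 - Dz T q) * Dz T q + (φ q.2.2 - T q) * Dz (Dz T) q
    - (Dz w q * (φ q.2.2 * T q - T q ^ 2 / 2)
      + w q * ((2 * profile' m q.2.2 + 1) * T q + φ q.2.2 * Dz T q - T q * Dz T q))
    + (Dz w q * profile m q.2.2 ^ 2 + w q * (2 * profile m q.2.2 * profile' m q.2.2)) with hW₃
  have cW₁ : ContinuousOn W₁' slab := by fun_prop
  have cW₂ : ContinuousOn W₂' slab := by fun_prop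
  have cW₃ : ContinuousOn W₃' slab := by fun_prop
  have div : ∫ q in cell Lx Ly, (W₁' q + W₂' q + W₃' q) = 0 := by
    refine setIntegral_cell_div hx hy
      (V₁ := fun q => (φ q.2.2 - T q) * Dx T q - u q * (φ q.2.2 * T q - T q ^ 2 / 2)
        + u q * profile m q.2.2 ^ 2)
      (V₂ := fun q => (φ q.2.2 - T q) * Dy T q - v q * (φ q.2.2 * T q - T q ^ 2 / 2)
        + v q * profile m q.2.2 ^ 2)
      (V₃ := fun q => (φ q.2.2 - T q) * Dz T q - w q * (φ q.2.2 * T q - T q ^ 2 / 2)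
        + w q * profile m q.2.2 ^ 2)
      (by fun_prop) cW₁ cW₂ cW₃ (fun x y z hz => ?_) (fun x y z hz => ?_) (fun x y z hz => ?_)
      ?_ ?_ (fun x y => ?_) (fun x y => ?_)
    · have hz' := Ioo_subset_Icc_self hz
      have hT := hasDerivAt_Dx T1 (x := x) (y := y) hz'
      have hu := hasDerivAt_Dx u1 (x := x) (y := y) hz'
      refine ((((hT.const_sub (φ z)).mul (hasDerivAt_Dx (contDiffOn_Dx T2) hz')).sub
        (hu.mul ((hT.const_mul (φ z)).sub ((hT.pow 2).div_const 2)))).add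
        (hu.mul_const (profile m z ^ 2))).congr_deriv ?_
      simp only [hW₁, Pi.pow_apply, Pi.sub_apply]; push_cast; ring
    · have hz' := Ioo_subset_Icc_self hz
      have hT := hasDerivAt_Dy T1 (x := x) (y := y) hz'
      have hu := hasDerivAt_Dy v1 (x := x) (y := y) hz'
      refine ((((hT.const_sub (φ z)).mul (hasDerivAt_Dy (contDiffOn_Dy T2) hz')).sub
        (hu.mul ((hT.const_mul (φ z)).sub ((hT.pow 2).div_const 2)))).add
        (hu.mul_const (profile m z ^ 2))).congr_deriv ?_
      simp only [hW₂, Pi.pow_apply, Pi.sub_apply]; push_cast; ring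
    · have hT := hasDerivAt_Dz T1 (x := x) (y := y) hz
      have hw := hasDerivAt_Dz w1 (x := x) (y := y) hz
      refine (((((dφ z).sub hT).mul (hasDerivAt_Dz (contDiffOn_Dz T2) hz)).sub
        (hw.mul (((dφ z).mul hT).sub ((hT.pow 2).div_const 2)))).add
        (hw.mul ((hasDerivAt_profile m z).pow 2))).congr_deriv ?_
      simp only [hW₃, Pi.pow_apply, Pi.sub_apply, Pi.mul_apply]; push_cast; ring
    · intro x y z h0 h1
      have a := h.T_per x y z h0 h1
      have b := h.flow.u_per x y z h0 h1
      have c := h.T_per.Dx T1 x y z h0 h1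
      simp only [a.1, a.2, b.1, b.2, c.1, c.2, and_self]
    · intro x y z h0 h1
      have a := h.T_per x y z h0 h1
      have b := h.flow.v_per x y z h0 h1
      have c := h.T_per.Dy T1 x y z h0 h1
      simp only [a.1, a.2, b.1, b.2, c.1, c.2, and_self]
    · simp [(h.flow.bot x y).2.2, h.T_bot, hφ, profile]; norm_num
    · simp [(h.flow.top x y).2.2, h.T_top, hφ, profile]
  have I : ∀ {g : Pt → ℝ}, ContinuousOn g slab → IntegrableOn g (cell Lx Ly) := fun hg =>
    ContinuousOn.integrableOn_cell hg
  -- Since φ' = 2τ' + 1, the constant 1 yields the whole flux; the terms with 2τ' complete |∇T|² to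
  -- |∇θ|² - τ'².
  have pointwise : ∫ q in cell Lx Ly, (w q * T q - Dz T q)
      = ∫ q in cell Lx Ly, (multiplier m T q * Tt q - (W₁' q + W₂' q + W₃' q)
        + profile' m q.2.2 ^ 2 - (Dx (deviation m T) q ^ 2 + Dy (deviation m T) q ^ 2
        + Dz (deviation m T) q ^ 2) - 2 * profile' m q.2.2 * w q * deviation m T q) := by
    refine integral_congr_ae ?_
    filter_upwards [ae_mem_openSlab Lx Ly] with q hq
    obtain ⟨x, y, z⟩ := q
    have hz := openSlab_subset_slab hq
    rw [Dx_deviation T1 hz, Dy_deviation T1 hz, Dz_deviation T1 hq]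
    have e1 := h.heat _ hq
    have e2 := h.flow.div_free _ hq
    simp only [hW₁, hW₂, hW₃, multiplier, deviation, hφ]
    -- The coefficients are the multiplier, for the heat equation, and the scalar factor of u in the
    -- field, for incompressibility.
    linear_combination (-(2 * profile m z - (1 - z) - T (x, y, z))) * e1
      + (-((2 * profile m z - (1 - z)) * T (x, y, z) - T (x, y, z) ^ 2 / 2)
        + profile m z ^ 2) * e2
  have lhs : ∫ q in cell Lx Ly, (w q * T q - Dz T q)
      = (∫ q in cell Lx Ly, w q * T q) + Lx * Ly := by
    rw [integral_sub (f := fun q => w q * T q) (I (cw.mul cT)) (I cTz),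
      setIntegral_Dz hx hy T1 h.T_bot h.T_top]
    ring
  rw [← lhs, pointwise, integral_sub (I (by fun_prop)) (I (by fun_prop)),
    integral_sub (I (by fun_prop)) (I (by fun_prop)),
    integral_add (I (by fun_prop)) (I (by fun_prop)),
    integral_sub (I (by fun_prop)) (I (by fun_prop)), div,
    integral_add (I (by fun_prop)) (I (by fun_prop)),
    integral_add (I (by fun_prop)) (I (by fun_prop)), dissipation]
  ring

/-- The background bound at one instant. -/
theorem flux_le (h : Snapshot Lx Ly R T Tt u v w p) (hx : 0 < Lx) (hy : 0 < Ly)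
    (hR : 0 < R) {m : ℕ} {s : ℝ} (hs : 0 < s) (hsm : s ^ 2 = m + 1) (hsR : 1585 * R ≤ s ^ 5) :
    (∫ q in cell Lx Ly, w q * T q) + Lx * Ly
      ≤ (∫ q in cell Lx Ly, multiplier m T q * Tt q) + Lx * Ly * (m + 1) := by
  have a := h.energy_identity hx hy m
  have b := h.spectral_constraint hx hy hR hs hsm hsR
  have c := setIntegral_profile'_sq_le hx hy m
  linarith

/-- The convective flux is controlled by the temperature in `L²`. -/
theorem abs_convection_le (h : Snapshot Lx Ly R T Tt u v w p) (hx : 0 < Lx) (hy : 0 < Ly) :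
    |∫ q in cell Lx Ly, w q * T q| ≤ (R ^ 2 + 1) * ∫ q in cell Lx Ly, T q ^ 2 := by
  have cw := h.flow.w_smooth.continuousOn
  have cT := h.T_smooth.continuousOn
  have I : ∀ {g : Pt → ℝ}, ContinuousOn g slab → IntegrableOn g (cell Lx Ly) := fun hg =>
    ContinuousOn.integrableOn_cell hg
  have c2 : ContinuousOn (fun q => w q ^ 2) slab := cw.pow 2
  have hw : ∫ q in cell Lx Ly, w q ^ 2 ≤ R ^ 2 * ∫ q in cell Lx Ly, T q ^ 2 := by
    rw [setIntegral_cell_slice c2]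
    calc ∫ z in (0 : ℝ)..1, slice Lx Ly (fun q => w q ^ 2) z
        ≤ ∫ _z in (0 : ℝ)..1, R ^ 2 * ∫ q in cell Lx Ly, T q ^ 2 :=
          intervalIntegral.integral_mono_on zero_le_one
            ((continuousOn_slice c2).intervalIntegrable_of_Icc zero_le_one) (by simp)
            fun z hz => h.flow.slice_sq_le hx hy hz
      _ = _ := by simp
  calc |∫ q in cell Lx Ly, w q * T q| ≤ ∫ q in cell Lx Ly, |w q * T q| :=
        abs_integral_le_integral_abs
    _ ≤ ∫ q in cell Lx Ly, (w q ^ 2 + T q ^ 2) := by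
        refine integral_mono (I (by fun_prop)) (I (by fun_prop)) fun q => ?_
        simp only
        rw [abs_le]
        constructor <;> nlinarith [sq_nonneg (w q - T q), sq_nonneg (w q + T q),
          sq_nonneg (w q), sq_nonneg (T q)]
    _ = (∫ q in cell Lx Ly, w q ^ 2) + ∫ q in cell Lx Ly, T q ^ 2 :=
        integral_add (I c2) (I (by fun_prop))
    _ ≤ _ := by linarith

end Snapshot

/-! ### Evolution in time and the Nusselt number -/

/-- The time derivative of the temperature, up to the plates. -/
def timeDeriv (T : ℝ → Pt → ℝ) (t : ℝ) (q : Pt) : ℝ :=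
  fderivWithin ℝ (fun r : ℝ × Pt => T r.1 r.2) (Ioi 0 ×ˢ slab) (t, q) (1, 0)

/-- The multiplier primitive `(2τ - (1 - z)) T - T² / 2` integrated over the cell. -/
def lyapunov (Lx Ly : ℝ) (m : ℕ) (T : ℝ → Pt → ℝ) (t : ℝ) : ℝ :=
  ∫ q in cell Lx Ly, ((2 * profile m q.2.2 - (1 - q.2.2)) * T t q - T t q ^ 2 / 2)

namespace IsSolution

variable {Ra Lx Ly : ℝ} {T ux uy uz p : ℝ → Pt → ℝ}

theorem continuousOn_timeDeriv (h : IsSolution Ra Lx Ly T ux uy uz p) :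
    ContinuousOn (Function.uncurry (timeDeriv T)) (Ioi 0 ×ˢ slab) :=
  (h.T_contDiffOn.continuousOn_fderivWithin
    ((uniqueDiffOn_Ioi 0).prod uniqueDiffOn_slab) le_rfl).clm_apply continuousOn_const

theorem hasDerivAt_timeDeriv (h : IsSolution Ra Lx Ly T ux uy uz p) {t : ℝ} (ht : 0 < t) {q : Pt}
    (hq : q ∈ slab) : HasDerivAt (fun s => T s q) (timeDeriv T t q) t :=
  ((h.T_contDiffOn.differentiableOn one_ne_zero) (t, q) ⟨ht, hq⟩).hasFDerivWithinAt.comp_hasDerivAt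
    (f := fun s : ℝ => (s, q)) t ((hasDerivAt_id t).prodMk (hasDerivAt_const t q))
    (by filter_upwards [lt_mem_nhds ht] with s hs using ⟨hs, hq⟩)

theorem slice_time {f : ℝ → Pt → ℝ} (hf : ContinuousOn (Function.uncurry f) (Ioi 0 ×ˢ slab))
    {t : ℝ} (ht : 0 < t) : ContinuousOn (f t) slab :=
  hf.comp (f := fun q => (t, q)) (by fun_prop) fun _ hq => ⟨ht, hq⟩

/-- Passes from ordinary partial derivatives in the open layer to derivatives continuous up to the
plates, so that the estimates at a fixed time apply. -/
theorem snapshot (h : IsSolution Ra Lx Ly T ux uy uz p) {t : ℝ} (ht : 0 < t) :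
    Snapshot Lx Ly Ra (T t) (timeDeriv T t) (ux t) (uy t) (uz t) (p t) := by
  have o1 : ∀ {f : Pt → ℝ}, ContDiffOn ℝ 2 f slab → ContDiffOn ℝ 1 f slab :=
    fun hf => hf.of_le (by norm_num)
  have hT := h.T_contDiffOn_space t ht
  have hu := h.ux_contDiffOn_space t ht
  have hv := h.uy_contDiffOn_space t ht
  have hw := h.uz_contDiffOn_space t ht
  have hp := h.p_contDiffOn_space t ht
  refine ⟨⟨hu, hv, hw, hp, hT.continuousOn, h.ux_periodic t ht, h.uy_periodic t ht,
    h.uz_periodic t ht, h.p_periodic t ht, fun q hq => ?_, fun q hq => ?_, fun q hq => ?_,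
    fun q hq => ?_, h.no_slip_bottom t ht, h.no_slip_top t ht⟩, hT, h.T_periodic t ht,
    slice_time h.continuousOn_timeDeriv ht, fun q hq => ?_, h.T_bottom t ht, h.T_top t ht⟩
  · have := h.incompressible t ht q hq
    rwa [dx_eq (o1 hu) (openSlab_subset_slab hq), dy_eq (o1 hv) (openSlab_subset_slab hq),
      dz_eq (o1 hw) hq] at this
  · have := h.momentum_x t ht q hq
    rw [dx_eq hp (openSlab_subset_slab hq), lap_eq hu hq] at this
    linarith
  · have := h.momentum_y t ht q hq
    rw [dy_eq hp (openSlab_subset_slab hq), lap_eq hv hq] at this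
    linarith
  · have := h.momentum_z t ht q hq
    rw [dz_eq hp hq, lap_eq hw hq] at this
    linarith
  · have := h.temperature t ht q hq
    rw [dx_eq (o1 hT) (openSlab_subset_slab hq), dy_eq (o1 hT) (openSlab_subset_slab hq),
      dz_eq (o1 hT) hq, lap_eq hT hq,
      (h.hasDerivAt_timeDeriv ht (openSlab_subset_slab hq)).deriv] at this
    linarith

theorem fluxDensity_ae (h : IsSolution Ra Lx Ly T ux uy uz p) {t : ℝ} (ht : 0 < t) :
    fluxDensity T uz t =ᵐ[volume.restrict (cell Lx Ly)]
      fun q => uz t q * T t q - Dz (T t) q := by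
  filter_upwards [ae_mem_openSlab Lx Ly] with q hq
  rw [fluxDensity, dz_eq ((h.T_contDiffOn_space t ht).of_le (by norm_num)) hq]

theorem continuousOn_convection (h : IsSolution Ra Lx Ly T ux uy uz p) {t : ℝ} (ht : 0 < t) :
    ContinuousOn (fun q => uz t q * T t q) slab :=
  (h.uz_contDiffOn_space t ht).continuousOn.mul (h.T_contDiffOn_space t ht).continuousOn

theorem integrableOn_fluxDensity (h : IsSolution Ra Lx Ly T ux uy uz p) {t : ℝ} (ht : 0 < t) :
    IntegrableOn (fluxDensity T uz t) (cell Lx Ly) := by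
  refine Integrable.congr ?_ (h.fluxDensity_ae ht).symm
  exact ContinuousOn.integrableOn_cell ((h.continuousOn_convection ht).sub
    (continuousOn_Dz ((h.T_contDiffOn_space t ht).of_le (by norm_num))))

theorem heatFlux_eq (h : IsSolution Ra Lx Ly T ux uy uz p) (hx : 0 < Lx) (hy : 0 < Ly)
    {t : ℝ} (ht : 0 < t) : heatFlux Lx Ly T uz t
      = (Lx * Ly)⁻¹ * ((∫ q in cell Lx Ly, uz t q * T t q) + Lx * Ly) := by
  have T1 : ContDiffOn ℝ 1 (T t) slab := (h.T_contDiffOn_space t ht).of_le (by norm_num)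
  rw [heatFlux, integral_congr_ae (h.fluxDensity_ae ht), integral_sub
    (f := fun q => uz t q * T t q)
    (ContinuousOn.integrableOn_cell (h.continuousOn_convection ht))
    (ContinuousOn.integrableOn_cell (continuousOn_Dz T1)),
    setIntegral_Dz hx hy T1 (h.T_bottom t ht) (h.T_top t ht), sub_neg_eq_add]

theorem time_cell {f : ℝ × Pt → ℝ} (hf : ContinuousOn f (Ioi 0 ×ˢ slab)) :
    ContinuousOn f (Ioi 0 ×ˢ cell Lx Ly) := hf.mono (prod_mono_right (cell_subset_slab Lx Ly))

theorem continuousOn_heatFlux (h : IsSolution Ra Lx Ly T ux uy uz p) (hx : 0 < Lx) (hy : 0 < Ly) :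
    ContinuousOn (heatFlux Lx Ly T uz) (Ioi 0) := by
  have c : ContinuousOn (fun t => ∫ q in cell Lx Ly, uz t q * T t q) (Ioi 0) :=
    continuousOn_setIntegral (f := fun t q => uz t q * T t q) (isCompact_cell Lx Ly)
      (time_cell (h.uz_continuousOn.mul h.T_contDiffOn.continuousOn))
  refine ((c.add_const (Lx * Ly)).const_mul (Lx * Ly)⁻¹).congr fun t ht => ?_
  exact h.heatFlux_eq hx hy ht

theorem continuousOn_multiplier (h : IsSolution Ra Lx Ly T ux uy uz p) (m : ℕ) :
    ContinuousOn (fun r : ℝ × Pt => multiplier m (T r.1) r.2 * timeDeriv T r.1 r.2)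
      (Ioi 0 ×ˢ slab) := by
  have cT := h.T_contDiffOn.continuousOn
  have ct : ContinuousOn (fun r : ℝ × Pt => timeDeriv T r.1 r.2) (Ioi 0 ×ˢ slab) :=
    h.continuousOn_timeDeriv
  have cp := continuous_profile m
  unfold multiplier
  fun_prop

theorem hasDerivAt_lyapunov (h : IsSolution Ra Lx Ly T ux uy uz p) (m : ℕ) {t : ℝ} (ht : 0 < t) :
    HasDerivAt (lyapunov Lx Ly m T)
      (∫ q in cell Lx Ly, multiplier m (T t) q * timeDeriv T t q) t := by
  have cT := h.T_contDiffOn.continuousOn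
  have cp := continuous_profile m
  refine hasDerivAt_setIntegral (S := Ioi 0)
    (f := fun t q => (2 * profile m q.2.2 - (1 - q.2.2)) * T t q - T t q ^ 2 / 2)
    (f' := fun t q => multiplier m (T t) q * timeDeriv T t q) isOpen_Ioi (isCompact_cell Lx Ly)
    (time_cell (f := fun r : ℝ × Pt =>
      (2 * profile m r.2.2.2 - (1 - r.2.2.2)) * T r.1 r.2 - T r.1 r.2 ^ 2 / 2) (by fun_prop))
    (time_cell (h.continuousOn_multiplier m)) (fun s hs q hq => ?_) ht
  have d := h.hasDerivAt_timeDeriv hs (cell_subset_slab Lx Ly hq)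
  refine ((d.const_mul _).sub ((d.pow 2).div_const 2)).congr_deriv ?_
  simp only [multiplier]; push_cast; ring

/-- Completing the square, φT - T²/2 ≤ φ²/2 ≤ 2 because |φ| ≤ 2. The bound is independent of T and
hence uniform in time. -/
theorem lyapunov_le (h : IsSolution Ra Lx Ly T ux uy uz p) (hx : 0 < Lx) (hy : 0 < Ly) (m : ℕ)
    {t : ℝ} (ht : 0 < t) : lyapunov Lx Ly m T t ≤ 2 * (Lx * Ly) := by
  have cT := (h.T_contDiffOn_space t ht).continuousOn
  have cp := continuous_profile m
  have cf : ContinuousOn (fun q : Pt => (2 * profile m q.2.2 - (1 - q.2.2)) * T t q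
      - T t q ^ 2 / 2) slab := by fun_prop
  have vol : ∫ q in cell Lx Ly, (2 : ℝ) = 2 * (Lx * Ly) := by
    rw [setIntegral_cell_slice continuousOn_const]
    simp only [slice, setIntegral_const, volume_rect hx hy]
    simp; ring
  rw [← vol]
  refine setIntegral_mono_on (ContinuousOn.integrableOn_cell cf)
    (ContinuousOn.integrableOn_cell continuousOn_const) (measurableSet_cell Lx Ly) fun q hq => ?_
  have h0 : 0 ≤ 1 - q.2.2 := by linarith [hq.2.2.2]
  have h1 : 1 - q.2.2 ≤ 1 := by linarith [hq.2.2.1]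
  have p0 : 0 ≤ profile m q.2.2 := pow_nonneg h0 _
  have p1 : profile m q.2.2 ≤ 1 := pow_le_one₀ h0 h1
  have : (2 * profile m q.2.2 - (1 - q.2.2)) ^ 2 ≤ 2 ^ 2 := by
    rw [sq_le_sq, abs_le]
    norm_num
    constructor <;> linarith
  nlinarith [sq_nonneg (2 * profile m q.2.2 - (1 - q.2.2) - T t q)]

/-- The temperature stays bounded in `L²` near the initial time. -/
theorem eventually_sq_le (h : IsSolution Ra Lx Ly T ux uy uz p) :
    ∃ M : ℝ, ∀ᶠ t in 𝓝[>] (0 : ℝ), ∫ q in cell Lx Ly, T t q ^ 2 ≤ M := by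
  set μ := volume.restrict (cell Lx Ly) with hμ
  have hfin : eLpNorm (T 0) 2 μ ≠ ∞ := h.initial_memLp.eLpNorm_ne_top
  set K := (eLpNorm (T 0) 2 μ).toReal with hK
  refine ⟨(1 + K) ^ 2, ?_⟩
  filter_upwards [h.initial_tendsto.eventually_lt_const (zero_lt_one' ℝ≥0∞),
    self_mem_nhdsWithin] with t ht1 ht
  have cT : ContinuousOn (T t) slab := (h.T_contDiffOn_space t ht).continuousOn
  have cTc := cT.mono (cell_subset_slab Lx Ly)
  have meas : AEStronglyMeasurable (T t) μ :=
    cTc.aestronglyMeasurable_of_isCompact (isCompact_cell Lx Ly) (measurableSet_cell Lx Ly)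
  have b : eLpNorm (T t) 2 μ ≤ ENNReal.ofReal (1 + K) := by
    have e : T t = (fun q => T t q - T 0 q) + T 0 := by funext q; simp
    rw [e]
    refine (eLpNorm_add_le (meas.sub h.initial_memLp.1) h.initial_memLp.1 (by norm_num)).trans ?_
    rw [ENNReal.ofReal_add zero_le_one ENNReal.toReal_nonneg, ENNReal.ofReal_one,
      ENNReal.ofReal_toReal hfin]
    exact add_le_add_left ht1.le _
  have mem : MemLp (T t) 2 μ := ⟨meas, b.trans_lt ENNReal.ofReal_lt_top⟩
  rw [mem.eLpNorm_eq_integral_rpow_norm (by norm_num) (by norm_num)] at b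
  have K0 : 0 ≤ 1 + K := add_nonneg zero_le_one ENNReal.toReal_nonneg
  have b' := (ENNReal.ofReal_le_ofReal_iff K0).1 b
  have nn : 0 ≤ ∫ q in cell Lx Ly, T t q ^ 2 := integral_nonneg fun q => sq_nonneg _
  have e2 : ∫ q, ‖T t q‖ ^ (2 : ℝ≥0∞).toReal ∂μ = ∫ q in cell Lx Ly, T t q ^ 2 := by
    congr 1; funext q; simp
  rw [e2] at b'
  calc ∫ q in cell Lx Ly, T t q ^ 2
      = ((∫ q in cell Lx Ly, T t q ^ 2) ^ ((2 : ℝ≥0∞).toReal⁻¹)) ^ 2 := by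
        rw [← Real.rpow_natCast, ← Real.rpow_mul nn]; norm_num
    _ ≤ (1 + K) ^ 2 := by gcongr

theorem abs_heatFlux_le (h : IsSolution Ra Lx Ly T ux uy uz p) (hx : 0 < Lx) (hy : 0 < Ly)
    {t : ℝ} (ht : 0 < t) : |heatFlux Lx Ly T uz t|
      ≤ (Lx * Ly)⁻¹ * ((Ra ^ 2 + 1) * (∫ q in cell Lx Ly, T t q ^ 2) + Lx * Ly) := by
  rw [h.heatFlux_eq hx hy ht, abs_mul, abs_of_nonneg (by positivity : 0 ≤ (Lx * Ly)⁻¹)]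
  refine mul_le_mul_of_nonneg_left ((abs_add_le _ _).trans ?_) (by positivity)
  rw [abs_of_pos (mul_pos hx hy)]
  exact add_le_add_left ((h.snapshot ht).abs_convection_le hx hy) _

/-- Away from t = 0 the flux is continuous. Near 0 its convective part is bounded by a multiple of
∫T², which stays bounded by L² convergence to the initial value, and its conductive part is
constant. -/
theorem intervalIntegrable_heatFlux (h : IsSolution Ra Lx Ly T ux uy uz p) (hx : 0 < Lx)
    (hy : 0 < Ly) {t : ℝ} (ht : 0 < t) :
    IntervalIntegrable (heatFlux Lx Ly T uz) volume 0 t := by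
  obtain ⟨M, hM⟩ := h.eventually_sq_le
  obtain ⟨ε, hε, hMε⟩ := mem_nhdsGT_iff_exists_Ioo_subset.1 hM
  have hε0 : (0 : ℝ) < ε := hε
  obtain ⟨B, hB⟩ := isCompact_Icc.exists_bound_of_continuousOn
    ((h.continuousOn_heatFlux hx hy).mono (t := Icc (ε / 2) t) fun s hs =>
      (half_pos hε0).trans_le hs.1)
  rw [intervalIntegrable_iff_integrableOn_Ioc_of_le ht.le]
  refine IntegrableOn.of_bound (by simp) ?_
    (max B ((Lx * Ly)⁻¹ * ((Ra ^ 2 + 1) * M + Lx * Ly))) ?_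
  · exact ((h.continuousOn_heatFlux hx hy).mono fun s hs => hs.1).aestronglyMeasurable
      measurableSet_Ioc
  · refine (ae_restrict_iff' measurableSet_Ioc).2 (.of_forall fun s hs => ?_)
    rcases lt_or_ge s ε with hsε | hsε
    · refine le_max_of_le_right ((h.abs_heatFlux_le hx hy hs.1).trans ?_)
      have := hMε ⟨hs.1, hsε⟩
      simp only [mem_ofPred_eq] at this
      gcongr
    · exact le_max_of_le_left (hB s ⟨by linarith, hs.2⟩)

/-- Integrates the instantaneous bound, in which the multiplier term is an exact time derivative.
Starting at time 1 avoids any differentiability at t = 0; the value of the functional at time 1 is a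
fixed constant. -/
theorem integral_heatFlux_le (h : IsSolution Ra Lx Ly T ux uy uz p) (hx : 0 < Lx) (hy : 0 < Ly)
    (hR : 0 < Ra) {m : ℕ} {s : ℝ} (hs : 0 < s) (hsm : s ^ 2 = m + 1) (hsR : 1585 * Ra ≤ s ^ 5)
    {t : ℝ} (ht : 1 ≤ t) :
    ∫ r in (1 : ℝ)..t, heatFlux Lx Ly T uz r
      ≤ 2 - (Lx * Ly)⁻¹ * lyapunov Lx Ly m T 1 + (m + 1) * (t - 1) := by
  have hsub : Icc 1 t ⊆ Ioi (0 : ℝ) := fun r hr => zero_lt_one.trans_le hr.1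
  have cG : ContinuousOn (fun r => ∫ q in cell Lx Ly, multiplier m (T r) q * timeDeriv T r q)
      (Ioi 0) :=
    continuousOn_setIntegral (f := fun r q => multiplier m (T r) q * timeDeriv T r q)
      (isCompact_cell Lx Ly) (time_cell (h.continuousOn_multiplier m))
  have iG : IntervalIntegrable
      (fun r => ∫ q in cell Lx Ly, multiplier m (T r) q * timeDeriv T r q) volume 1 t :=
    (cG.mono hsub).intervalIntegrable_of_Icc ht
  have A0 : 0 < Lx * Ly := mul_pos hx hy
  have FTC : ∫ r in (1 : ℝ)..t, (∫ q in cell Lx Ly, multiplier m (T r) q * timeDeriv T r q)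
      = lyapunov Lx Ly m T t - lyapunov Lx Ly m T 1 := by
    refine intervalIntegral.integral_eq_sub_of_hasDerivAt (fun r hr => ?_) iG
    rw [uIcc_of_le ht] at hr
    exact h.hasDerivAt_lyapunov m (hsub hr)
  calc ∫ r in (1 : ℝ)..t, heatFlux Lx Ly T uz r
      ≤ ∫ r in (1 : ℝ)..t, ((Lx * Ly)⁻¹ *
          (∫ q in cell Lx Ly, multiplier m (T r) q * timeDeriv T r q) + (m + 1)) := by
        refine intervalIntegral.integral_mono_on ht
          (((h.continuousOn_heatFlux hx hy).mono hsub).intervalIntegrable_of_Icc ht)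
          ((iG.const_mul _).add (by simp)) fun r hr => ?_
        rw [h.heatFlux_eq hx hy (hsub hr)]
        have := mul_le_mul_of_nonneg_left
          ((h.snapshot (hsub hr)).flux_le hx hy hR hs hsm hsR) (inv_pos.2 A0).le
        refine this.trans_eq ?_
        field_simp
    _ = (Lx * Ly)⁻¹ * (lyapunov Lx Ly m T t - lyapunov Lx Ly m T 1) + (m + 1) * (t - 1) := by
        rw [intervalIntegral.integral_add (iG.const_mul _) (by simp),
          intervalIntegral.integral_const_mul, FTC]
        simp; ring
    _ ≤ _ := by
        have := mul_le_mul_of_nonneg_left (h.lyapunov_le hx hy m (zero_lt_one.trans_le ht))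
          (inv_pos.2 A0).le
        have e : (Lx * Ly)⁻¹ * (2 * (Lx * Ly)) = 2 := by field_simp
        rw [e] at this
        rw [mul_sub]
        linarith

/-- The background bound for the Nusselt number. -/
theorem nusselt_le (h : IsSolution Ra Lx Ly T ux uy uz p) (hx : 0 < Lx) (hy : 0 < Ly)
    (hR : 0 < Ra) {m : ℕ} {s : ℝ} (hs : 0 < s) (hsm : s ^ 2 = m + 1) (hsR : 1585 * Ra ≤ s ^ 5) :
    nusselt Lx Ly T uz ≤ ((m + 1 : ℝ) : EReal) := by
  -- `K` collects everything independent of t, so it vanishes in the average as t → ∞.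
  set K := (∫ r in (0 : ℝ)..1, heatFlux Lx Ly T uz r) + 2
    - (Lx * Ly)⁻¹ * lyapunov Lx Ly m T 1 - (m + 1) with hK
  have lim : Tendsto (fun t : ℝ => t⁻¹ * K + (m + 1)) atTop (𝓝 (m + 1)) := by
    have := (tendsto_inv_atTop_zero (𝕜 := ℝ)).mul_const K
    simpa using this.add_const ((m : ℝ) + 1)
  have limE := (EReal.tendsto_coe.2 lim).limsup_eq
  rw [← limE, nusselt]
  refine limsup_le_limsup ?_
  filter_upwards [eventually_ge_atTop (1 : ℝ)] with t ht
  have ht0 : 0 < t := zero_lt_one.trans_le ht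
  rw [EReal.coe_le_coe_iff]
  have split := intervalIntegral.integral_add_adjacent_intervals
    (h.intervalIntegrable_heatFlux hx hy zero_lt_one)
    ((h.intervalIntegrable_heatFlux hx hy zero_lt_one).symm.trans
      (h.intervalIntegrable_heatFlux hx hy ht0))
  have b := h.integral_heatFlux_le hx hy hR hs hsm hsR ht
  have : ∫ r in (0 : ℝ)..t, heatFlux Lx Ly T uz r ≤ K + t * (m + 1) := by
    rw [← split, hK]; linarith
  refine (mul_le_mul_of_nonneg_left this (inv_pos.2 ht0).le).trans_eq ?_
  field_simp

end IsSolution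

end RayleighBenard

end

/-! ### Choice of the layer width -/

theorem mainTheorem2 :
    ∃ C : ℝ, 0 < C ∧
      ∀ (Lx Ly Ra : ℝ), 0 < Lx → 0 < Ly → 1 ≤ Ra →
      ∀ (T ux uy uz p : ℝ → RayleighBenard.Pt → ℝ),
        RayleighBenard.IsSolution Ra Lx Ly T ux uy uz p →
          (∀ s : ℝ, 0 < s →
            IntegrableOn (RayleighBenard.fluxDensity T uz s) (RayleighBenard.cell Lx Ly)) ∧
          (∀ t : ℝ, 0 < t →
            IntervalIntegrable (RayleighBenard.heatFlux Lx Ly T uz) volume 0 t) ∧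
          RayleighBenard.nusselt Lx Ly T uz ≤ ((C * Ra ^ (2 / 5 : ℝ) : ℝ) : EReal) := by
  refine ⟨1586, by norm_num, fun Lx Ly Ra hx hy hRa T ux uy uz p h =>
    ⟨fun s hs => h.integrableOn_fluxDensity hs,
      fun t ht => h.intervalIntegrable_heatFlux hx hy ht, ?_⟩⟩
  have hR : 0 < Ra := zero_lt_one.trans_le hRa
  set a := Ra ^ (2 / 5 : ℝ) with ha
  have ha1 : 1 ≤ a := Real.one_le_rpow hRa (by norm_num)
  -- Then m + 1 ≥ 1585 Ra^(2/5), which gives (m+1)^(5/2) ≥ 1585 Ra with room to spare, while m + 1 ≤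
  -- 1585a + 1 ≤ 1586a because a ≥ 1. This is the constant 1586.
  set m := ⌊1585 * a⌋₊ with hm
  have m1 : 1585 * a ≤ m + 1 := (Nat.lt_floor_add_one _).le
  have m2 : (m : ℝ) ≤ 1585 * a := Nat.floor_le (by positivity)
  have hsq : √(m + 1 : ℝ) ^ 2 = m + 1 := Real.sq_sqrt (by positivity)
  have big : 1585 * Ra ≤ √(m + 1 : ℝ) ^ 5 := by
    have a5 : a ^ 5 = Ra ^ 2 := by
      rw [ha, ← Real.rpow_natCast, ← Real.rpow_mul hR.le, ← Real.rpow_natCast]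
      norm_num
    -- Squaring replaces the half-integer power by integer powers, with a⁵ = Ra².
    refine le_of_sq_le_sq ?_ (by positivity)
    calc (1585 * Ra) ^ 2 = 1585 ^ 2 * a ^ 5 := by rw [a5]; ring
      _ ≤ 1585 ^ 5 * a ^ 5 := by gcongr <;> norm_num
      _ = (1585 * a) ^ 5 := by ring
      _ ≤ (m + 1 : ℝ) ^ 5 := by gcongr
      _ = (√(m + 1 : ℝ) ^ 5) ^ 2 := by
        rw [← pow_mul, mul_comm, pow_mul, hsq]
  refine (h.nusselt_le hx hy hR (Real.sqrt_pos.2 (by positivity)) hsq big).trans ?_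
  rw [EReal.coe_le_coe_iff]
  linarith
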